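/- For $n\ge 0$ let $\mathcal D_n$ be the set of Dyck paths of semilength $n$, i.e. words with $n$ up steps $u$ and $n$ down steps $d$ in which every prefix has at least as many $u$'s as $d$'s. For $D\in\mathcal D_n$ and $1\le i\le n-1$ let $r_i(D)$ be the number of down steps between the $i$-th and $(i+1)$-st up step of $D$, let $s_i(D)$ be the number of up steps between the $i$-th and $(i+1)$-st down step of $D$, and set $$L(D)=\prod_{i=1}^{n-1}\binom{r_i(D)+s_i(D)}{r_i(D)}.$$ Let $\mathcal D_n^k=\{D\in\mathcal D_n : L(D)=k\}$. A Motzkin path of length $m$ is a path from $(0,0)$ to $(m,0)$ with steps $(1,1)$ (up), $(1,-1)$ (down) and $(1,0)$ (horizontal) that does not pass below the $x$-axis. Let $M_m$ be the number of Motzkin paths of length $m$, with $M_m=0$ for $m<0$. For $k\ge 1$, let $T_{m,k}$ be the number of Motzkin paths of length $m$ whose first down step is in position $k$ if $m\ge k$, and put $T_{k-1,k}=1$ (counting the path consisting of $k-1$ horizontal steps) and $T_{m,k}=0$ for $m<k-1$. **Theorem.** For every integer $n\ge 4$, $$|\mathcal D_n^4| = 2\left(T_{n-2,3}+\sum_{i=0}^{n-6}(i+1)M_i\,T_{n-4-i,3}\right)+\binom{n-5}{2}M_{n-7}+M_{n-5}+2\sum_{i=0}^{n-7}(i+1)M_iM_{n-7-i},$$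 where sums whose upper limit is negative are empty. Moreover $|\mathcal D_3^4|=1$. -/

import Mathlib

/-! ### Dyck paths and the statistic `L`

A Dyck path is Mathlib's `DyckWord`. -/

/-- `rStat D i` is the number of down steps of `D` that lie between the `i`-th and the
`(i+1)`-st up step, i.e. that are preceded by exactly `i` up steps. -/
def rStat (D : DyckWord) (i : ℕ) : ℕ :=
  ((Finset.range D.toList.length).filter fun j =>
    D.toList[j]? = some DyckStep.D ∧ (D.toList.take j).count DyckStep.U = i).card

/-- `sStat D i` is the number of up steps of `D` that lie between the `i`-th and the
`(i+1)`-st down step, i.e. that are preceded by exactly `i` down steps. -/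
def sStat (D : DyckWord) (i : ℕ) : ℕ :=
  ((Finset.range D.toList.length).filter fun j =>
    D.toList[j]? = some DyckStep.U ∧ (D.toList.take j).count DyckStep.D = i).card

/-- `L(D) = ∏_{i=1}^{n-1} (r_i(D) + s_i(D) choose r_i(D))`, where `n` is the semilength of `D`. -/
def dyckL (D : DyckWord) : ℕ :=
  ∏ i ∈ Finset.Ico 1 D.semilength, (rStat D i + sStat D i).choose (rStat D i)

/-- The set of Dyck paths `D` of semilength `n` with `L(D) = k`. -/
def dyckPathsWithL (n k : ℕ) : Set DyckWord :=
  {D | D.semilength = n ∧ dyckL D = k}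

/-! ### Motzkin paths -/

/-- The steps of a Motzkin path: up `(1,1)`, down `(1,-1)`, horizontal `(1,0)`. -/
inductive MotzkinStep
  | u : MotzkinStep
  | d : MotzkinStep
  | h : MotzkinStep
  deriving DecidableEq

/-- A word in `u`, `d`, `h` is a Motzkin path if it ends on the axis and never passes below it. -/
def IsMotzkinPath (w : List MotzkinStep) : Prop :=
  w.count MotzkinStep.u = w.count MotzkinStep.d ∧
    ∀ i : ℕ, (w.take i).count MotzkinStep.d ≤ (w.take i).count MotzkinStep.u

/-- The Motzkin paths of length `m`. The index is an integer, so that there are none for `m < 0`. -/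
def motzkinPaths (m : ℤ) : Set (List MotzkinStep) :=
  {w | IsMotzkinPath w ∧ (w.length : ℤ) = m}

/-- The Motzkin number `M_m`; it is `0` for `m < 0`. -/
noncomputable def motzkinNumber (m : ℤ) : ℕ := (motzkinPaths m).ncard

/-- The Motzkin paths of length `m` whose first down step is in position `k` (positions are counted
from `1`); if `m = k - 1`, this is by convention the single path made of `k - 1` horizontal steps.
The set is empty if `m < k - 1`. -/
def motzkinBallotPaths (m : ℤ) (k : ℕ) : Set (List MotzkinStep) :=
  {w | w ∈ motzkinPaths m ∧
    ((MotzkinStep.d ∈ w ∧ w.idxOf MotzkinStep.d + 1 = k) ∨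
      (m = (k : ℤ) - 1 ∧ w = List.replicate (k - 1) MotzkinStep.h))}

/-- The Motzkin ballot number `T_{m,k}`. -/
noncomputable def motzkinBallotNumber (m : ℤ) (k : ℕ) : ℕ := (motzkinBallotPaths m k).ncard

/-!
# Dyck paths with `L = 4`

A Dyck path of semilength `m + 1` is determined by its turning points. Give position `i` in
`1, …, m` a *down mark* if the `i`-th up step is followed by a down step, that is `r_i > 0`, and an
*up mark* if the `i`-th down step is followed by an up step, that is `s_i > 0`. The words of marks
which occur are the Motzkin paths of length `m` in which the horizontal steps have two colours: a
position with only an up mark is an up step, one with only a down mark is a down step, and the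
letter `none` stands for both marks (`ncard_dyckPathsWithL`). A position carrying at most one mark
contributes the factor `1` to `L`, and a letter `none` contributes `(r + s).choose r ≥ 2`, where `r`
and `s` are distances between consecutive marks. Hence `L = 4` means that there is one letter `none`
with `{r, s} = {1, 3}`, or that there are two letters `none` with `r = s = 1`.

The marks relevant for `r` and `s` are matched first in, first out: if the letter `none` stands at
height `a`, then `s` is the distance between the `a`-th and the `(a + 1)`-st down mark to its right,
and `r` is found in the same way in the path read backwards (`one_none_iff`, `two_none_iff`). A path
that starts at height `a` can take its steps between two consecutive down steps to the front, as
long as these are among the first `a + 1` blocks. So for counting, the prescribed gap may be assumed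
to come first (`gapSeries_eq`).

The counting is done with generating functions in `ℤ⟦X⟧`. Write `M` for the series of the Motzkin
numbers, `Y = X * M` and `K = 1 / (1 - X - 2 * X * Y)`, so that `K * (1 - Y ^ 2) = M`. There are
`(X * (1 + Y)) ^ (s - 1) * Y ^ a` paths from height `a` to the axis with prescribed gap `s`.
Summing over `a` gives `X ^ 2 * (1 + Y) ^ 2 / (1 - Y ^ 2)` for one letter `none` with given `r` and
`s` (`coeff_wordSum_oneCut`). For two letters `none` at the heights `a` and `b`, with the word `Q`
between them, there are two cases. If `Q` has fewer than `a` down steps, each outer word has two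
gaps equal to `1` (`wordSum_two_gaps`). Otherwise `Q` has a doubled down step and a doubled up step,
which can be undone (`wordSum_two_sided_gaps`). Altogether this gives
`1 + X ^ 4 * K ^ 3 + X ^ 2 * M + 2 * X ^ 4 * M ^ 2 * K` (`coeff_wordSum_twoCuts`).

Finally `M * K = ∑ (i + 1) * M_i * X ^ i` and `K ^ 3 = ∑ (i + 2).choose 2 * M_i * X ^ i`, since the
first series is the derivative of `X * M` and the second is half the second derivative of
`X ^ 2 * M`; and `(X * (1 + Y)) ^ 2` is the series of the numbers `T_{m,3}`. Comparing coefficients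
gives the formula; the constant term `1` of the two-letter series is the path `ududud`, the only one
for semilength `3`.
-/

/-! ### Generating functions of words -/

section WordSums

open PowerSeries

variable {α β ι κ : Type*} [Fintype α] [Fintype β] [Fintype κ]

/-- The coefficients of `wordSum`, by recursion on the degree: a word is empty or has a first
letter. -/
noncomputable def wordSumCoeff : ℕ → (List α → ℤ⟦X⟧) → ℤ
  | 0, f => coeff 0 (f [])
  | N + 1, f => coeff (N + 1) (f []) + ∑ x : α, wordSumCoeff N fun w => f (x :: w)

/-- The formal sum `∑ X ^ |w| * f w` over all words `w` in the alphabet `α`. -/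
noncomputable def wordSum (f : List α → ℤ⟦X⟧) : ℤ⟦X⟧ := PowerSeries.mk fun N => wordSumCoeff N f

/-- Splitting off the first letter. -/
theorem wordSum_eq (f : List α → ℤ⟦X⟧) :
    wordSum f = f [] + X * ∑ x : α, wordSum fun w => f (x :: w) := by
  ext N
  cases N with
  | zero => simp [wordSum, wordSumCoeff]
  | succ N => simp [wordSum, wordSumCoeff, coeff_succ_X_mul]

/-- A family of power series is zero if each member is `X` times a sum of members. This proves
identities between sums over words by induction on the first letter. -/
theorem eq_zero_of_eq_X_mul_sum (F : ι → ℤ⟦X⟧) (next : ι → κ → ι)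
    (h : ∀ i, F i = X * ∑ k, F (next i k)) (i : ι) : F i = 0 := by
  ext N
  induction N generalizing i with
  | zero => rw [h i]; simp
  | succ N ih => rw [h i, coeff_succ_X_mul, map_sum]; simp [ih]

/-- The coefficient of `X ^ N` only depends on the words of length at most `N`. -/
theorem wordSum_congr_coeff {f g : List α → ℤ⟦X⟧} {N : ℕ}
    (h : ∀ w : List α, w.length ≤ N → ∀ k ≤ N, coeff k (f w) = coeff k (g w)) :
    coeff N (wordSum f) = coeff N (wordSum g) := by
  induction N generalizing f g with
  | zero => simpa [wordSum, wordSumCoeff] using h [] (by simp) 0 le_rfl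
  | succ N ih =>
    rw [wordSum_eq f, wordSum_eq g]
    simp only [map_add, coeff_succ_X_mul, map_sum]
    rw [h [] (by simp) _ le_rfl]
    congr 1
    refine Finset.sum_congr rfl fun x _ => ih fun w hw k hk => ?_
    exact h (x :: w) (by simpa using hw) k (by omega)

theorem wordSum_zero : wordSum (fun _ : List α => 0) = 0 :=
  eq_zero_of_eq_X_mul_sum (κ := α) (fun _ : Unit => wordSum fun _ : List α => 0) (fun _ _ => ())
    (fun _ => by conv_lhs => rw [wordSum_eq, zero_add]) ()

theorem wordSum_add (f g : List α → ℤ⟦X⟧) :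
    wordSum (fun w => f w + g w) = wordSum f + wordSum g := by
  have := eq_zero_of_eq_X_mul_sum (κ := α)
    (fun p : (List α → ℤ⟦X⟧) × (List α → ℤ⟦X⟧) =>
      wordSum (fun w => p.1 w + p.2 w) - (wordSum p.1 + wordSum p.2))
    (fun p x => (fun w => p.1 (x :: w), fun w => p.2 (x :: w)))
    (fun p => by
      dsimp only
      rw [wordSum_eq, wordSum_eq p.1, wordSum_eq p.2, Finset.sum_sub_distrib,
        Finset.sum_add_distrib]
      ring) (f, g)
  exact sub_eq_zero.mp this

theorem wordSum_mul_left (c : ℤ⟦X⟧) (f : List α → ℤ⟦X⟧) :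
    wordSum (fun w => c * f w) = c * wordSum f := by
  have := eq_zero_of_eq_X_mul_sum (κ := α)
    (fun p : List α → ℤ⟦X⟧ => wordSum (fun w => c * p w) - c * wordSum p)
    (fun p x => fun w => p (x :: w))
    (fun p => by
      rw [wordSum_eq, wordSum_eq p, Finset.sum_sub_distrib, ← Finset.mul_sum]
      ring) f
  exact sub_eq_zero.mp this

theorem wordSum_mul_right (c : ℤ⟦X⟧) (f : List α → ℤ⟦X⟧) :
    wordSum (fun w => f w * c) = wordSum f * c := by
  simp_rw [mul_comm _ c]
  exact wordSum_mul_left c f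

theorem wordSum_sum {σ : Type*} (s : Finset σ) (f : σ → List α → ℤ⟦X⟧) :
    wordSum (fun w => ∑ i ∈ s, f i w) = ∑ i ∈ s, wordSum (f i) := by
  classical
  induction s using Finset.induction_on with
  | empty => simpa using wordSum_zero
  | insert a s ha ih => simp only [Finset.sum_insert ha, wordSum_add, ih]

theorem wordSum_comm (f : List α → List β → ℤ⟦X⟧) :
    (wordSum fun P => wordSum fun Q => f P Q) = wordSum fun Q => wordSum fun P => f P Q := by
  have := eq_zero_of_eq_X_mul_sum (κ := α)
    (fun g : List α → List β → ℤ⟦X⟧ =>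
      (wordSum fun P => wordSum fun Q => g P Q) - wordSum fun Q => wordSum fun P => g P Q)
    (fun g x => fun P Q => g (x :: P) Q)
    (fun g => by
      have h : (fun Q => wordSum fun P => g P Q) =
          fun Q => g [] Q + X * ∑ x, wordSum fun P => g (x :: P) Q :=
        funext fun Q => wordSum_eq _
      rw [h, wordSum_add, wordSum_mul_left, wordSum_sum, wordSum_eq, Finset.sum_sub_distrib]
      ring) f
  exact sub_eq_zero.mp this

/-- Splitting off the last letter. -/
theorem wordSum_eq_append (f : List α → ℤ⟦X⟧) :
    wordSum f = f [] + X * ∑ x : α, wordSum fun w => f (w ++ [x]) := by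
  have := eq_zero_of_eq_X_mul_sum (κ := α)
    (fun g : List α → ℤ⟦X⟧ => wordSum g - (g [] + X * ∑ x : α, wordSum fun w => g (w ++ [x])))
    (fun g x => fun w => g (x :: w))
    (fun g => by
      have h : ∀ x : α, wordSum (fun w => g (w ++ [x])) =
          g [x] + X * ∑ y, wordSum fun w => g (y :: (w ++ [x])) := fun x => by
        rw [wordSum_eq]; simp
      simp only [h, Finset.sum_add_distrib, Finset.sum_sub_distrib, ← Finset.mul_sum]
      rw [wordSum_eq, Finset.sum_comm]
      ring) f
  exact sub_eq_zero.mp this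

theorem wordSum_reverse (f : List α → ℤ⟦X⟧) : wordSum (fun w => f w.reverse) = wordSum f := by
  have := eq_zero_of_eq_X_mul_sum (κ := α)
    (fun g : List α → ℤ⟦X⟧ => wordSum (fun w => g w.reverse) - wordSum g)
    (fun g x => fun w => g (w ++ [x]))
    (fun g => by
      rw [wordSum_eq, wordSum_eq_append g, Finset.sum_sub_distrib]
      simp only [List.reverse_nil, List.reverse_cons]
      ring) f
  exact sub_eq_zero.mp this

theorem wordSum_map (σ : α ≃ β) (f : List β → ℤ⟦X⟧) :
    wordSum (fun w => f (w.map σ)) = wordSum f := by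
  have := eq_zero_of_eq_X_mul_sum (κ := β)
    (fun g : List β → ℤ⟦X⟧ => wordSum (fun w => g (w.map σ)) - wordSum g)
    (fun g x => fun w => g (x :: w))
    (fun g => by
      rw [wordSum_eq, wordSum_eq g, Finset.sum_sub_distrib,
        ← Equiv.sum_comp σ fun x => wordSum fun w => g (x :: w.map σ)]
      simp only [List.map_nil, List.map_cons]
      ring) f
  exact sub_eq_zero.mp this

/-- A word with a distinguished letter `none` either avoids this letter or splits uniquely at its
first occurrence. -/
theorem wordSum_option (f : List (Option α) → ℤ⟦X⟧) :
    wordSum f = (wordSum fun P : List α => f (P.map some)) +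
      X * wordSum fun P : List α => wordSum fun w => f (P.map some ++ none :: w) := by
  have := eq_zero_of_eq_X_mul_sum (κ := α)
    (fun g : List (Option α) → ℤ⟦X⟧ => wordSum g - ((wordSum fun P : List α => g (P.map some)) +
      X * wordSum fun P : List α => wordSum fun w => g (P.map some ++ none :: w)))
    (fun g x => fun w => g (some x :: w))
    (fun g => by
      rw [wordSum_eq, wordSum_eq (fun P : List α => g (P.map some)),
        wordSum_eq (fun P : List α => wordSum fun w => g (P.map some ++ none :: w)),
        Fintype.sum_option, Finset.sum_sub_distrib, Finset.sum_add_distrib, ← Finset.mul_sum]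
      simp only [List.map_nil, List.map_cons, List.nil_append, List.cons_append]
      ring) f
  exact sub_eq_zero.mp this

theorem finite_setOf_length_eq (N : ℕ) (p : List α → Prop) :
    {w : List α | w.length = N ∧ p w}.Finite :=
  (List.finite_length_eq α N).subset fun _ hw => hw.1

/-- The sum over words of an indicator function counts words by length. -/
theorem coeff_wordSum_ite (N : ℕ) (p : List α → Prop) [DecidablePred p] :
    coeff N (wordSum fun w => if p w then 1 else 0) =
      ({w : List α | w.length = N ∧ p w}.ncard : ℤ) := by
  classical
  induction N generalizing p with
  | zero =>
    have : {w : List α | w.length = 0 ∧ p w} = if p [] then {[]} else ∅ := by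
      ext w
      cases w <;> split_ifs <;> simp_all
    rw [this, wordSum, coeff_mk, wordSumCoeff]
    split_ifs <;> simp
  | succ N ih =>
    rw [wordSum_eq, map_add, coeff_succ_X_mul, map_sum]
    have h0 : coeff (N + 1) (if p [] then (1 : ℤ⟦X⟧) else 0) = 0 := by
      split_ifs <;> simp [coeff_one]
    rw [h0, zero_add]
    simp only [ih]
    have hset : {w : List α | w.length = N + 1 ∧ p w} =
        ↑(Finset.univ.biUnion fun x : α =>
          ((finite_setOf_length_eq N fun w => p (x :: w)).toFinset.image (x :: ·))) := by
      ext w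
      cases w with
      | nil => simp
      | cons y w => simp
    rw [hset, Set.ncard_coe_finset, Finset.card_biUnion]
    · push_cast
      refine Finset.sum_congr rfl fun x _ => ?_
      rw [Finset.card_image_of_injective _ (List.cons_injective),
        Set.ncard_eq_toFinset_card _ (finite_setOf_length_eq N fun w => p (x :: w))]
    · intro x _ y _ hxy
      rw [Function.onFun, Finset.disjoint_left]
      intro w hw hw'
      simp only [Finset.mem_image] at hw hw'
      obtain ⟨a, -, rfl⟩ := hw
      obtain ⟨b, -, hb⟩ := hw'
      exact hxy (List.cons.inj hb).1.symm

end WordSums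

/-! ### Paths with prescribed end heights -/

namespace MotzkinStep

instance : Fintype MotzkinStep := ⟨{u, d, h}, fun x => by cases x <;> simp⟩

theorem sum_univ {A : Type*} [AddCommMonoid A] (f : MotzkinStep → A) :
    ∑ x, f x = f u + f h + f d := by
  have : (Finset.univ : Finset MotzkinStep) = {u, h, d} := by decide
  rw [this, Finset.sum_insert (by decide), Finset.sum_insert (by decide), Finset.sum_singleton,
    add_assoc]

/-- The involution exchanging up and down steps. -/
def swap : MotzkinStep ≃ MotzkinStep where
  toFun x := match x with | u => d | d => u | h => h
  invFun x := match x with | u => d | d => u | h => h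
  left_inv x := by cases x <;> rfl
  right_inv x := by cases x <;> rfl

end MotzkinStep

/-- `Climb a w b` says that the path with step sequence `w` leads from height `a` to height `b` and
does not pass below the axis. -/
def Climb : ℕ → List MotzkinStep → ℕ → Prop
  | a, [], b => a = b
  | a, .u :: w, b => Climb (a + 1) w b
  | a, .h :: w, b => Climb a w b
  | 0, .d :: _, _ => False
  | a + 1, .d :: w, b => Climb a w b

@[simp] theorem climb_nil {a b : ℕ} : Climb a [] b ↔ a = b := by simp [Climb]
@[simp] theorem climb_u {a b : ℕ} {w} : Climb a (.u :: w) b ↔ Climb (a + 1) w b := by simp [Climb]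
@[simp] theorem climb_h {a b : ℕ} {w} : Climb a (.h :: w) b ↔ Climb a w b := by simp [Climb]
@[simp] theorem climb_zero_d {b : ℕ} {w} : Climb 0 (.d :: w) b ↔ False := by simp [Climb]
@[simp] theorem climb_succ_d {a b : ℕ} {w} : Climb (a + 1) (.d :: w) b ↔ Climb a w b := by
  simp [Climb]

theorem Climb.count {a b : ℕ} {w : List MotzkinStep} (hw : Climb a w b) :
    a + w.count .u = b + w.count .d := by
  induction w generalizing a with
  | nil => simpa using hw
  | cons x w ih =>
    cases x
    · simp only [climb_u] at hw
      have := ih hw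
      simp; omega
    · cases a with
      | zero => simp at hw
      | succ a =>
        simp only [climb_succ_d] at hw
        have := ih hw
        simp; omega
    · simp only [climb_h] at hw
      have := ih hw
      simp; omega

theorem climb_append {a b : ℕ} {P Q : List MotzkinStep} :
    Climb a (P ++ Q) b ↔ ∃ c, Climb a P c ∧ Climb c Q b := by
  induction P generalizing a with
  | nil => simp
  | cons x P ih =>
    cases x
    · simp [ih]
    · cases a <;> simp [ih]
    · simp [ih]

/-- The path `w` read backwards. -/
def mirror (w : List MotzkinStep) : List MotzkinStep := (w.map MotzkinStep.swap).reverse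

theorem mirror_mirror (w : List MotzkinStep) : mirror (mirror w) = w := by
  have : (⇑MotzkinStep.swap ∘ ⇑MotzkinStep.swap) = id := by
    funext x; cases x <;> rfl
  simp [mirror, this]

theorem mirror_cons (x : MotzkinStep) (w : List MotzkinStep) :
    mirror (x :: w) = mirror w ++ [MotzkinStep.swap x] := by simp [mirror]

theorem count_d_mirror (w : List MotzkinStep) : (mirror w).count .d = w.count .u := by
  induction w with
  | nil => rfl
  | cons x w ih =>
    rw [mirror_cons, List.count_append, ih]; cases x <;> simp [MotzkinStep.swap]

theorem count_u_mirror (w : List MotzkinStep) : (mirror w).count .u = w.count .d := by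
  rw [← count_d_mirror, mirror_mirror]

theorem climb_mirror {a b : ℕ} {w : List MotzkinStep} : Climb a (mirror w) b ↔ Climb b w a := by
  induction w generalizing b with
  | nil => simp [mirror, eq_comm]
  | cons x w ih =>
    rw [mirror_cons, climb_append]
    simp only [ih]
    cases x
    · simp only [MotzkinStep.swap, climb_u, Equiv.coe_fn_mk]
      constructor
      · rintro ⟨_ | c, h1, h2⟩
        · simp at h2
        · simp at h2; exact h2 ▸ h1
      · exact fun h => ⟨_, h, by simp⟩
    · simp only [MotzkinStep.swap, climb_u, Equiv.coe_fn_mk, climb_nil]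
      constructor
      · rintro ⟨c, h1, rfl⟩
        simpa using h1
      · cases b with
        | zero => simp
        | succ b => exact fun h => ⟨b, by simpa using h, rfl⟩
    · simp [MotzkinStep.swap]

theorem wordSum_mirror (f : List MotzkinStep → PowerSeries ℤ) :
    wordSum (fun w => f (mirror w)) = wordSum f := by
  unfold mirror
  rw [wordSum_map MotzkinStep.swap fun w => f w.reverse, wordSum_reverse]

/-! ### Gaps between marked positions -/

/-- The distances between consecutive marked (`true`) positions of a list, where a marked position
is added before the first and after the last entry. -/
def gaps : List Bool → List ℕ
  | [] => [1]
  | true :: l => 1 :: gaps l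
  | false :: l => (gaps l).modifyHead (· + 1)

/-- The `i`-th of the distances `gaps l`, or `0` if there are fewer of them. -/
def gap (l : List Bool) (i : ℕ) : ℕ := (gaps l).getD i 0

theorem length_gaps (l : List Bool) : (gaps l).length = l.count true + 1 := by
  induction l with
  | nil => rfl
  | cons x l ih => cases x <;> simp [gaps, ih]

theorem gaps_ne_nil (l : List Bool) : gaps l ≠ [] := by
  rw [← List.length_pos_iff, length_gaps]; omega

theorem gaps_pos (l : List Bool) : ∀ x ∈ gaps l, 0 < x := by
  induction l with
  | nil => simp [gaps]
  | cons x l ih =>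
    cases x
    · obtain ⟨a, t, h⟩ := List.exists_cons_of_ne_nil (gaps_ne_nil l)
      rw [h] at ih
      simp only [gaps, h, List.modifyHead_cons, List.mem_cons, forall_eq_or_imp] at ih ⊢
      exact ⟨by omega, ih.2⟩
    · simpa [gaps] using ih

theorem sum_gaps (l : List Bool) : (gaps l).sum = l.length + 1 := by
  induction l with
  | nil => rfl
  | cons x l ih =>
    cases x
    · obtain ⟨a, t, h⟩ := List.exists_cons_of_ne_nil (gaps_ne_nil l)
      simp only [gaps, h, List.modifyHead_cons, List.sum_cons, List.length_cons] at ih ⊢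
      omega
    · simp [gaps, ih]; omega

theorem gaps_append_true (l m : List Bool) : gaps (l ++ true :: m) = gaps l ++ gaps m := by
  induction l with
  | nil => rfl
  | cons x l ih =>
    cases x
    · obtain ⟨a, t, h⟩ := List.exists_cons_of_ne_nil (gaps_ne_nil l)
      simp [gaps, ih, h]
    · simp [gaps, ih]

theorem gaps_append_false (l : List Bool) :
    gaps (l ++ [false]) = ((gaps l).reverse.modifyHead (· + 1)).reverse := by
  induction l with
  | nil => rfl
  | cons x l ih =>
    have hl := gaps_ne_nil l
    cases x
    · obtain ⟨a, t, h⟩ := List.exists_cons_of_ne_nil hl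
      rcases List.eq_nil_or_concat t with rfl | ⟨t, b, rfl⟩
      · simp [gaps, ih, h]
      · simp [gaps, ih, h]
    · rcases List.eq_nil_or_concat (gaps l) with h | ⟨t, b, h⟩
      · exact absurd h hl
      · simp [gaps, ih, h]

theorem gaps_reverse (l : List Bool) : gaps l.reverse = (gaps l).reverse := by
  induction l with
  | nil => rfl
  | cons x l ih =>
    cases x
    · rw [List.reverse_cons, gaps_append_false, ih, List.reverse_reverse]; rfl
    · rw [List.reverse_cons, gaps_append_true, ih]; simp [gaps]

@[simp] theorem gap_nil_zero : gap [] 0 = 1 := by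
  simp [gap, gaps]
@[simp] theorem gap_nil_succ (i : ℕ) : gap [] (i + 1) = 0 := by
  simp [gap, gaps]
@[simp] theorem gap_true_zero (l) : gap (true :: l) 0 = 1 := by
  simp [gap, gaps]
@[simp] theorem gap_true_succ (l i) : gap (true :: l) (i + 1) = gap l i := by
  simp [gap, gaps]
@[simp] theorem gap_false_zero (l) : gap (false :: l) 0 = gap l 0 + 1 := by
  obtain ⟨a, t, h⟩ := List.exists_cons_of_ne_nil (gaps_ne_nil l)
  simp [gap, gaps, h]
@[simp] theorem gap_false_succ (l i) : gap (false :: l) (i + 1) = gap l (i + 1) := by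
  obtain ⟨a, t, h⟩ := List.exists_cons_of_ne_nil (gaps_ne_nil l)
  simp [gap, gaps, h]

theorem gap_pos (l : List Bool) {i : ℕ} (hi : i ≤ l.count true) : 0 < gap l i := by
  have hi' : i < (gaps l).length := by rw [length_gaps]; omega
  rw [gap, List.getD_eq_getElem _ _ hi']
  exact gaps_pos l _ (List.getElem_mem hi')

theorem gap_eq_zero (l : List Bool) {i : ℕ} (hi : l.count true < i) : gap l i = 0 := by
  rw [gap, List.getD_eq_default]
  rw [length_gaps]; omega

theorem gap_append_true_left (l m : List Bool) {i : ℕ} (hi : i ≤ l.count true) :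
    gap (l ++ true :: m) i = gap l i := by
  rw [gap, gap, gaps_append_true, List.getD_append]
  rw [length_gaps]; omega

theorem gap_append_true_right (l m : List Bool) (i : ℕ) :
    gap (l ++ true :: m) (l.count true + 1 + i) = gap m i := by
  rw [gap, gap, gaps_append_true, List.getD_append_right, length_gaps]
  · congr 1; omega
  · rw [length_gaps]; omega

theorem gap_reverse (l : List Bool) {i : ℕ} (hi : i ≤ l.count true) :
    gap l.reverse i = gap l (l.count true - i) := by
  have h1 : i < (gaps l).reverse.length := by rw [List.length_reverse, length_gaps]; omega
  have h2 : l.count true - i < (gaps l).length := by rw [length_gaps]; omega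
  rw [gap, gap, gaps_reverse, List.getD_eq_getElem _ _ h1, List.getD_eq_getElem _ _ h2,
    List.getElem_reverse]
  congr 1
  rw [length_gaps]; omega

/-- The distances between consecutive down steps. -/
def downGap (w : List MotzkinStep) (i : ℕ) : ℕ := gap (w.map fun x => decide (x = .d)) i

/-- The distances between consecutive up steps. -/
def upGap (w : List MotzkinStep) (i : ℕ) : ℕ := gap (w.map fun x => decide (x = .u)) i

@[simp] theorem downGap_nil_zero : downGap [] 0 = 1 := by
  simp [downGap]
@[simp] theorem downGap_nil_succ (i : ℕ) : downGap [] (i + 1) = 0 := by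
  simp [downGap]
@[simp] theorem downGap_d_zero (w) : downGap (.d :: w) 0 = 1 := by
  simp [downGap]
@[simp] theorem downGap_d_succ (w i) : downGap (.d :: w) (i + 1) = downGap w i := by
  simp [downGap]
@[simp] theorem downGap_u_zero (w) : downGap (.u :: w) 0 = downGap w 0 + 1 := by simp [downGap]
@[simp] theorem downGap_u_succ (w i) : downGap (.u :: w) (i + 1) = downGap w (i + 1) := by
  simp [downGap]
@[simp] theorem downGap_h_zero (w) : downGap (.h :: w) 0 = downGap w 0 + 1 := by simp [downGap]
@[simp] theorem downGap_h_succ (w i) : downGap (.h :: w) (i + 1) = downGap w (i + 1) := by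
  simp [downGap]
@[simp] theorem upGap_u_zero (w) : upGap (.u :: w) 0 = 1 := by
  simp [upGap]
@[simp] theorem upGap_u_succ (w i) : upGap (.u :: w) (i + 1) = upGap w i := by
  simp [upGap]
@[simp] theorem upGap_d_zero (w) : upGap (.d :: w) 0 = upGap w 0 + 1 := by simp [upGap]
@[simp] theorem upGap_d_succ (w i) : upGap (.d :: w) (i + 1) = upGap w (i + 1) := by
  simp [upGap]
@[simp] theorem upGap_h_zero (w) : upGap (.h :: w) 0 = upGap w 0 + 1 := by simp [upGap]
@[simp] theorem upGap_h_succ (w i) : upGap (.h :: w) (i + 1) = upGap w (i + 1) := by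
  simp [upGap]

theorem count_true_map_eq (w : List MotzkinStep) (a : MotzkinStep) :
    (w.map fun x => decide (x = a)).count true = w.count a := by
  induction w with
  | nil => rfl
  | cons x w ih => by_cases h : x = a <;> simp [h, ih]

theorem downGap_pos (w : List MotzkinStep) {i : ℕ} (hi : i ≤ w.count .d) : 0 < downGap w i :=
  gap_pos _ (by rwa [count_true_map_eq])

theorem upGap_pos (w : List MotzkinStep) {i : ℕ} (hi : i ≤ w.count .u) : 0 < upGap w i :=
  gap_pos _ (by rwa [count_true_map_eq])

theorem le_count_of_downGap_pos {w : List MotzkinStep} {i : ℕ} (hi : 0 < downGap w i) :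
    i ≤ w.count .d := by
  by_contra! h
  rw [downGap, gap_eq_zero _ (by rwa [count_true_map_eq])] at hi
  exact hi.false

theorem downGap_mirror (w : List MotzkinStep) {i : ℕ} (hi : i ≤ w.count .u) :
    downGap (mirror w) i = upGap w (w.count .u - i) := by
  have h : (mirror w).map (fun x => decide (x = .d)) =
      (w.map fun x => decide (x = .u)).reverse := by
    rw [mirror, List.map_reverse, List.map_map]
    congr 2
    funext x; cases x <;> rfl
  rw [downGap, h, gap_reverse, count_true_map_eq]
  · rfl
  · rwa [count_true_map_eq]

/-! ### Generating functions of paths -/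

section PathSeries

open PowerSeries
open scoped Classical

/-- The generating function of the paths from height `a` to the axis. -/
noncomputable def descentSeries (a : ℕ) : ℤ⟦X⟧ := wordSum fun w => if Climb a w 0 then 1 else 0

/-- The generating function of the Motzkin numbers. -/
noncomputable def motzkinSeries : ℤ⟦X⟧ := descentSeries 0

/-- The generating function `X * M` of the Motzkin paths followed by a down step. -/
noncomputable def motzkinStepSeries : ℤ⟦X⟧ := X * motzkinSeries

/-- The series `1 / (1 - X - 2 X Y)`, where `Y = X * M`. -/
noncomputable def trinomialSeries : ℤ⟦X⟧ :=
  invOfUnit (1 - X - 2 * X * motzkinStepSeries) 1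

local notation "M" => motzkinSeries
local notation "Y" => motzkinStepSeries
local notation "K" => trinomialSeries

theorem descentSeries_zero : descentSeries 0 = 1 + X * (descentSeries 1 + descentSeries 0) := by
  conv_lhs => rw [descentSeries, wordSum_eq]
  simp [MotzkinStep.sum_univ, wordSum_zero, descentSeries]

theorem descentSeries_succ (a : ℕ) :
    descentSeries (a + 1) = X * (descentSeries (a + 2) + descentSeries (a + 1) +
      descentSeries a) := by
  conv_lhs => rw [descentSeries, wordSum_eq]
  simp [MotzkinStep.sum_univ, descentSeries]

/-- The recursion for paths ending at the axis, by the first step, has no nonzero homogeneous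
solution. -/
theorem eq_zero_of_height_recursion (F : ℕ → ℤ⟦X⟧) (h0 : F 0 = X * (F 1 + F 0))
    (hs : ∀ a, F (a + 1) = X * (F (a + 2) + F (a + 1) + F a)) (a : ℕ) : F a = 0 := by
  ext N
  induction N generalizing a with
  | zero => cases a <;> [rw [h0]; rw [hs]] <;> simp
  | succ N ih => cases a <;> [rw [h0]; rw [hs]] <;> simp [coeff_succ_X_mul, ih]

/-- A path from height `a + 1` to the axis splits at its first step below height `a + 1`. -/
theorem descentSeries_succ_eq (a : ℕ) : descentSeries (a + 1) = Y * descentSeries a := by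
  refine sub_eq_zero.mp (eq_zero_of_height_recursion
    (fun a => descentSeries (a + 1) - Y * descentSeries a) ?_ (fun a => ?_) a)
  · have h1 := descentSeries_succ 0
    have h0 := descentSeries_zero
    have hY : Y = X * descentSeries 0 := rfl
    simp only [zero_add, one_add_one_eq_two] at *
    linear_combination h1 - Y * h0 - hY
  · have h1 := descentSeries_succ (a + 1)
    have h0 := descentSeries_succ a
    linear_combination h1 - Y * h0

theorem descentSeries_eq (a : ℕ) : descentSeries a = M * Y ^ a := by
  induction a with
  | zero => simp [motzkinSeries]
  | succ a ih => rw [descentSeries_succ_eq, ih]; ring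

theorem motzkinStepSeries_def : Y = X * M := rfl

theorem motzkinSeries_eq : M = 1 + X * (Y * M + M) := by
  have := descentSeries_zero
  rw [descentSeries_succ_eq] at this
  exact this

theorem motzkinStepSeries_eq : Y = X * (1 + Y + Y ^ 2) := by
  linear_combination X * motzkinSeries_eq +
    (1 - X - X * Y) * motzkinStepSeries_def

theorem trinomialSeries_mul : K * (1 - X - 2 * X * Y) = 1 := by
  rw [mul_comm]
  refine mul_invOfUnit _ _ ?_
  simp [motzkinStepSeries_def]

theorem trinomialSeries_mul_one_sub_sq : K * (1 - Y ^ 2) = M := by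
  linear_combination M * trinomialSeries_mul - K * motzkinSeries_eq -
    K * Y * motzkinStepSeries_def

/-- The geometric series `1 / (1 - Y ^ 2)`. -/
theorem one_add_mul_one_sub_sq : (1 + X * Y * K) * (1 - Y ^ 2) = 1 := by
  linear_combination X * Y * trinomialSeries_mul_one_sub_sq - Y * motzkinStepSeries_def

theorem X_pow_dvd_motzkinStepSeries_pow (a : ℕ) : (X : ℤ⟦X⟧) ^ a ∣ Y ^ a :=
  pow_dvd_pow_of_dvd ⟨M, rfl⟩ a

/-! ### Paths with one prescribed gap -/

/-- The generating function of the paths from height `a` to the axis whose `i`-th gap between down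
steps, counted from `0`, is `s`. -/
noncomputable def gapSeries (a i s : ℕ) : ℤ⟦X⟧ :=
  wordSum fun w => if Climb a w 0 ∧ downGap w i = s then 1 else 0

/-- The first gap is `s + 1` if the path begins with `s` up or horizontal steps, followed by a down
step or, on the axis, by the end of the path. -/
theorem gapSeries_first (a s : ℕ) : gapSeries a 0 (s + 1) = (X * (1 + Y)) ^ s * Y ^ a := by
  induction s generalizing a with
  | zero =>
    have hp (w : List MotzkinStep) : downGap w 0 ≠ 0 := (downGap_pos w (Nat.zero_le _)).ne'
    rw [gapSeries, wordSum_eq]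
    cases a with
    | zero => simp [MotzkinStep.sum_univ, wordSum_zero, hp]
    | succ a =>
      have h : (wordSum fun w => if Climb a w 0 then (1 : ℤ⟦X⟧) else 0) = M * Y ^ a :=
        descentSeries_eq a
      simp only [MotzkinStep.sum_univ, climb_nil, climb_u, climb_h, climb_succ_d, downGap_u_zero,
        downGap_h_zero, downGap_d_zero, downGap_nil_zero, zero_add, Nat.add_eq_right, hp,
        and_false, if_false, wordSum_zero, and_true, h, Nat.succ_ne_zero]
      rw [pow_succ, motzkinStepSeries_def]; ring
  | succ s ih =>
    rw [gapSeries, wordSum_eq]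
    have h (a : ℕ) : (wordSum fun w =>
        if Climb a w 0 ∧ downGap w 0 = s + 1 then (1 : ℤ⟦X⟧) else 0) =
          (X * (1 + Y)) ^ s * Y ^ a := ih a
    cases a <;> simp [MotzkinStep.sum_univ, wordSum_zero, h] <;> ring

/-- Moving the steps between two consecutive down steps to the front of a path shows that the number
of paths with a prescribed `i`-th gap does not depend on `i`, as long as the path has to make the
down steps in question because of its starting height. -/
theorem gapSeries_eq (a i s : ℕ) (hi : i ≤ a) :
    gapSeries a i (s + 1) = (X * (1 + Y)) ^ s * Y ^ a := by
  ext N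
  induction N generalizing a i with
  | zero =>
    cases i with
    | zero => rw [gapSeries_first]
    | succ i =>
      obtain ⟨a, rfl⟩ : ∃ b, a = b + 1 := ⟨a - 1, by omega⟩
      rw [gapSeries, wordSum_eq, pow_succ Y a]
      simp [motzkinStepSeries_def]
  | succ N ih =>
    cases i with
    | zero => rw [gapSeries_first]
    | succ i =>
      obtain ⟨a, rfl⟩ : ∃ b, a = b + 1 := ⟨a - 1, by omega⟩
      have h1 : gapSeries (a + 1) (i + 1) (s + 1) = X * (gapSeries (a + 2) (i + 1) (s + 1) +
          gapSeries (a + 1) (i + 1) (s + 1) + gapSeries a i (s + 1)) := by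
        conv_lhs => rw [gapSeries, wordSum_eq]
        simp [MotzkinStep.sum_univ, gapSeries]
      have h2 : (X * (1 + Y)) ^ s * Y ^ (a + 1) = X * ((X * (1 + Y)) ^ s * Y ^ (a + 2) +
          (X * (1 + Y)) ^ s * Y ^ (a + 1) + (X * (1 + Y)) ^ s * Y ^ a) := by
        linear_combination (X * (1 + Y)) ^ s * Y ^ a * motzkinStepSeries_eq
      rw [h1, h2, coeff_succ_X_mul, coeff_succ_X_mul, map_add, map_add, map_add, map_add,
        ih _ _ (by omega), ih _ _ (by omega), ih _ _ (by omega)]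

/-- Two different gaps are both equal to `1` as often as the first two gaps are. -/
theorem wordSum_two_gaps (a i j : ℕ) (hij : i < j) (hj : j ≤ a + 1) :
    (wordSum fun w => if Climb (a + 1) w 0 ∧ downGap w j = 1 ∧ downGap w i = 1
      then (1 : ℤ⟦X⟧) else 0) = X * Y ^ a := by
  ext N
  induction N generalizing a i j with
  | zero =>
    obtain ⟨j, rfl⟩ : ∃ b, j = b + 1 := ⟨j - 1, by omega⟩
    rw [wordSum_eq]
    simp
  | succ N ih =>
    obtain ⟨j, rfl⟩ : ∃ b, j = b + 1 := ⟨j - 1, by omega⟩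
    rw [wordSum_eq]
    cases i with
    | zero =>
      have hp (w : List MotzkinStep) : downGap w 0 ≠ 0 := (downGap_pos w (Nat.zero_le _)).ne'
      have h : (wordSum fun w => if Climb a w 0 ∧ downGap w j = 1 then (1 : ℤ⟦X⟧) else 0) =
          (X * (1 + Y)) ^ 0 * Y ^ a := gapSeries_eq a j 0 (by omega)
      simp [MotzkinStep.sum_univ, hp, wordSum_zero, h]
    | succ i =>
      obtain ⟨a, rfl⟩ : ∃ b, a = b + 1 := ⟨a - 1, by omega⟩
      have h2 : X * Y ^ (a + 1) = X * (X * Y ^ (a + 2) + X * Y ^ (a + 1) + X * Y ^ a) := by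
        linear_combination X * Y ^ a * motzkinStepSeries_eq
      rw [h2]
      simp only [MotzkinStep.sum_univ, climb_nil, climb_u, climb_h, climb_succ_d, downGap_u_succ,
        downGap_h_succ, downGap_d_succ, downGap_nil_succ, Nat.succ_ne_zero, false_and, if_false,
        zero_add]
      rw [coeff_succ_X_mul, coeff_succ_X_mul, map_add, map_add, map_add, map_add,
        ih _ _ _ (by omega) (by omega), ih _ _ _ (by omega) (by omega),
        ih _ _ _ (by omega) (by omega)]

/-! ### Paths with weighted end height -/

/-- The words with at most `a` down steps, weighted by the height they reach from height `a`. -/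
noncomputable def fewDownSeries (a : ℕ) : ℤ⟦X⟧ := wordSum fun w : List MotzkinStep =>
  if w.count .d ≤ a then Y ^ (a + w.count .u - w.count .d) else 0

/-- The paths starting at height `a`, weighted by their end height. -/
noncomputable def weightedPathSeries (a : ℕ) : ℤ⟦X⟧ := wordSum fun w : List MotzkinStep =>
  if Climb a w (a + w.count .u - w.count .d) then Y ^ (a + w.count .u - w.count .d) else 0

theorem fewDownSeries_eq (a : ℕ) : fewDownSeries a = (a + 1) * M * Y ^ a := by
  have hu (a : ℕ) : (wordSum fun w : List MotzkinStep => if (MotzkinStep.u :: w).count .d ≤ a then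
        Y ^ (a + (MotzkinStep.u :: w).count .u - (MotzkinStep.u :: w).count .d) else 0) =
      Y * fewDownSeries a := by
    rw [fewDownSeries, ← wordSum_mul_left]
    congr 1
    funext w
    simp only [List.count_cons_self, ne_eq, reduceCtorEq, not_false_eq_true, List.count_cons_of_ne]
    split_ifs with h
    · rw [← pow_succ']; congr 1; omega
    · simp
  have hh (a : ℕ) : (wordSum fun w : List MotzkinStep => if (MotzkinStep.h :: w).count .d ≤ a then
        Y ^ (a + (MotzkinStep.h :: w).count .u - (MotzkinStep.h :: w).count .d) else 0) =
      fewDownSeries a := by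
    simp [fewDownSeries]
  induction a with
  | zero =>
    have h : fewDownSeries 0 = 1 + X * (Y * fewDownSeries 0 + fewDownSeries 0) := by
      conv_lhs => rw [fewDownSeries, wordSum_eq, MotzkinStep.sum_univ, hu, hh]
      simp [wordSum_zero]
    push_cast
    linear_combination M * h - fewDownSeries 0 * motzkinSeries_eq
  | succ a ih =>
    have hd : (wordSum fun w : List MotzkinStep => if (MotzkinStep.d :: w).count .d ≤ a + 1 then
        Y ^ (a + 1 + (MotzkinStep.d :: w).count .u - (MotzkinStep.d :: w).count .d) else 0) =
      fewDownSeries a := by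
      rw [fewDownSeries]
      congr 1
      funext w
      simp only [List.count_cons_self, ne_eq, reduceCtorEq, not_false_eq_true,
        List.count_cons_of_ne, Nat.add_le_add_iff_right]
      congr 2
      omega
    have h : fewDownSeries (a + 1) = Y ^ (a + 1) + X * (Y * fewDownSeries (a + 1) +
        fewDownSeries (a + 1) + fewDownSeries a) := by
      conv_lhs => rw [fewDownSeries, wordSum_eq, MotzkinStep.sum_univ, hu, hh, hd]
      simp
    push_cast
    linear_combination M * h - fewDownSeries (a + 1) * motzkinSeries_eq + X * M * ih -
      (a + 1) * M * Y ^ a * motzkinStepSeries_def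

theorem weightedPathSeries_eq (a : ℕ) : weightedPathSeries a = (a + 1) * K * Y ^ a := by
  have hu (a : ℕ) : (wordSum fun w : List MotzkinStep =>
        if Climb a (.u :: w)
          (a + (MotzkinStep.u :: w).count .u - (MotzkinStep.u :: w).count .d) then
        Y ^ (a + (MotzkinStep.u :: w).count .u - (MotzkinStep.u :: w).count .d) else 0) =
      weightedPathSeries (a + 1) := by
    rw [weightedPathSeries]
    congr 1
    funext w
    simp only [List.count_cons_self, ne_eq, reduceCtorEq, not_false_eq_true, List.count_cons_of_ne,
      climb_u]
    rw [show a + (w.count .u + 1) - w.count .d = a + 1 + w.count .u - w.count .d by omega]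
  have hh (a : ℕ) : (wordSum fun w : List MotzkinStep =>
        if Climb a (.h :: w)
          (a + (MotzkinStep.h :: w).count .u - (MotzkinStep.h :: w).count .d) then
        Y ^ (a + (MotzkinStep.h :: w).count .u - (MotzkinStep.h :: w).count .d) else 0) =
      weightedPathSeries a := by
    simp [weightedPathSeries]
  have hd (a : ℕ) : (wordSum fun w : List MotzkinStep => if Climb (a + 1) (.d :: w)
          (a + 1 + (MotzkinStep.d :: w).count .u - (MotzkinStep.d :: w).count .d) then
        Y ^ (a + 1 + (MotzkinStep.d :: w).count .u - (MotzkinStep.d :: w).count .d) else 0) =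
      weightedPathSeries a := by
    rw [weightedPathSeries]
    congr 1
    funext w
    simp only [List.count_cons_self, ne_eq, reduceCtorEq, not_false_eq_true, List.count_cons_of_ne,
      climb_succ_d]
    rw [show a + 1 + w.count .u - (w.count .d + 1) = a + w.count .u - w.count .d by omega]
  have h0 : weightedPathSeries 0 = 1 + X * (weightedPathSeries 1 + weightedPathSeries 0) := by
    conv_lhs => rw [weightedPathSeries, wordSum_eq, MotzkinStep.sum_univ, hu, hh]
    simp [wordSum_zero]
  have hs (a : ℕ) : weightedPathSeries (a + 1) = Y ^ (a + 1) +
      X * (weightedPathSeries (a + 2) + weightedPathSeries (a + 1) + weightedPathSeries a) := by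
    conv_lhs => rw [weightedPathSeries, wordSum_eq, MotzkinStep.sum_univ, hu, hh, hd]
    simp
  refine sub_eq_zero.mp (eq_zero_of_height_recursion
    (fun a => weightedPathSeries a - (a + 1) * K * Y ^ a) ?_ (fun a => ?_) a)
  · push_cast
    linear_combination h0 - trinomialSeries_mul
  · push_cast
    linear_combination hs a - (a + 2) * K * Y ^ a * motzkinStepSeries_eq -
      X * Y ^ a * trinomialSeries_mul_one_sub_sq + Y ^ a * motzkinStepSeries_def

end PathSeries

/-! ### Doubling a down step -/

/-- Doubles the `m`-th down step of a path (counted from `0`); if there are exactly `m` down steps,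
a down step is appended. -/
def doubleDown : ℕ → List MotzkinStep → List MotzkinStep
  | 0, [] => [.d]
  | _ + 1, [] => []
  | m, .u :: w => .u :: doubleDown m w
  | m, .h :: w => .h :: doubleDown m w
  | 0, .d :: w => .d :: .d :: w
  | m + 1, .d :: w => .d :: doubleDown m w

@[simp] theorem doubleDown_zero_nil : doubleDown 0 [] = [.d] := by simp [doubleDown]
@[simp] theorem doubleDown_u (m w) : doubleDown m (.u :: w) = .u :: doubleDown m w := by
  cases m <;> simp [doubleDown]
@[simp] theorem doubleDown_h (m w) : doubleDown m (.h :: w) = .h :: doubleDown m w := by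
  cases m <;> simp [doubleDown]
@[simp] theorem doubleDown_zero_d (w) : doubleDown 0 (.d :: w) = .d :: .d :: w := by
  simp [doubleDown]
@[simp] theorem doubleDown_succ_d (m w) :
    doubleDown (m + 1) (.d :: w) = .d :: doubleDown m w := by
  simp [doubleDown]

theorem climb_doubleDown {m a b : ℕ} {w : List MotzkinStep} (hm : m ≤ w.count .d) (ha : m ≤ a) :
    Climb (a + 1) (doubleDown m w) b ↔ Climb a w b := by
  induction w generalizing m a with
  | nil =>
    obtain rfl : m = 0 := by simpa using hm
    simp
  | cons x w ih =>
    cases x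
    · simpa using ih (a := a + 1) (by simpa using hm) (by omega)
    · cases m with
      | zero => simp
      | succ m =>
        obtain ⟨a, rfl⟩ : ∃ c, a = c + 1 := ⟨a - 1, by omega⟩
        simpa using ih (a := a) (by simpa using hm) (by omega)
    · simpa using ih (a := a) (by simpa using hm) ha

theorem count_u_doubleDown {m : ℕ} {w : List MotzkinStep} (hm : m ≤ w.count .d) :
    (doubleDown m w).count .u = w.count .u := by
  induction w generalizing m with
  | nil =>
    obtain rfl : m = 0 := by simpa using hm
    simp
  | cons x w ih =>
    cases x
    · simpa using ih (by simpa using hm)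
    · cases m with
      | zero => simp
      | succ m => simpa using ih (by simpa using hm)
    · simpa using ih (by simpa using hm)

/-- Doubling a down step changes none of the adjacencies of two up steps. The last gap is excluded,
as a down step may be appended there. -/
theorem upGap_doubleDown {m i : ℕ} {w : List MotzkinStep} (hi : i < w.count .u) :
    upGap (doubleDown m w) i = 1 ↔ upGap w i = 1 := by
  have hp (w : List MotzkinStep) : upGap w 0 ≠ 0 := (upGap_pos w (Nat.zero_le _)).ne'
  induction w generalizing m i with
  | nil => simp at hi
  | cons x w ih =>
    cases x
    · cases i with
      | zero => simp
      | succ i => simpa using ih (by simpa using hi)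
    · have hi' : i < w.count .u := by simpa using hi
      cases m <;> cases i <;> simp [hp, ih hi']
    · have hi' : i < w.count .u := by simpa using hi
      cases i <;> simp [hp, ih hi']

section PairSeries

open PowerSeries
open scoped Classical

local notation "M" => motzkinSeries
local notation "Y" => motzkinStepSeries
local notation "K" => trinomialSeries

/-- The words whose `m`-th and `(m+1)`-st down steps are adjacent arise from all words with enough
down steps by doubling. -/
theorem wordSum_doubleDown (m : ℕ) (f : List MotzkinStep → ℤ⟦X⟧) :
    (wordSum fun w => if downGap w (m + 1) = 1 then f w else 0) =
      X * wordSum fun w => if m ≤ w.count .d then f (doubleDown m w) else 0 := by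
  have hp (w : List MotzkinStep) : downGap w 0 ≠ 0 := (downGap_pos w (Nat.zero_le _)).ne'
  ext N
  induction N generalizing m f with
  | zero => rw [wordSum_eq]; simp
  | succ N ih =>
    rw [wordSum_eq, wordSum_eq fun w => if m ≤ w.count .d then f (doubleDown m w) else 0]
    have hu := ih m fun w => f (.u :: w)
    have hh := ih m fun w => f (.h :: w)
    cases m with
    | zero =>
      have hd : (wordSum fun w => if downGap w 0 = 1 then f (.d :: w) else 0) =
          f [.d] + X * wordSum fun w => f (.d :: .d :: w) := by
        rw [wordSum_eq]
        simp [MotzkinStep.sum_univ, hp, wordSum_zero]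
      simp only [coeff_succ_X_mul] at hu hh ⊢
      simp [MotzkinStep.sum_univ] at hu hh ⊢
      rw [hd, hu, hh]
      simp [mul_add]
      ring
    | succ m =>
      have hd := ih m fun w => f (.d :: w)
      simp only [coeff_succ_X_mul] at hu hh ⊢
      simp [MotzkinStep.sum_univ] at hu hh hd ⊢
      rw [hu, hh, hd, ← map_add, ← map_add, ← mul_add, ← mul_add]

theorem downGap_mirror_doubleDown {m b : ℕ} {w : List MotzkinStep} (hm : m ≤ w.count .d) :
    downGap (mirror (doubleDown m w)) (b + 1) = 1 ↔ downGap (mirror w) (b + 1) = 1 := by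
  have hc := count_u_doubleDown hm
  by_cases hb : b + 1 ≤ w.count .u
  · rw [downGap_mirror _ (by omega), downGap_mirror _ hb, hc]
    exact upGap_doubleDown (by omega)
  · have h (v : List MotzkinStep) (hv : v.count .u = w.count .u) :
        downGap (mirror v) (b + 1) ≠ 1 := fun h1 => by
      have := le_count_of_downGap_pos (w := mirror v) (i := b + 1) (by omega)
      rw [count_d_mirror] at this
      omega
    simp [h _ hc, h _ rfl]

/-- Undoing the doubling of a down step and, in the path read backwards, of an up step. -/
theorem wordSum_two_sided_gaps (a b : ℕ) :
    (wordSum fun w => if Climb (a + 1) w (b + 1) ∧ downGap w (a + 1) = 1 ∧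
        downGap (mirror w) (b + 1) = 1 then (1 : ℤ⟦X⟧) else 0) =
      X ^ 2 * wordSum fun w => if a ≤ w.count .d ∧ Climb a w b then 1 else 0 := by
  calc _ = wordSum fun w => if downGap w (a + 1) = 1 then
            (if Climb (a + 1) w (b + 1) ∧ downGap (mirror w) (b + 1) = 1 then (1 : ℤ⟦X⟧) else 0)
            else 0 := by
        congr 1; funext w; rw [← ite_and]; congr 1; rw [eq_iff_iff]; tauto
    _ = X * wordSum fun w => if a ≤ w.count .d ∧ Climb a w (b + 1) ∧
          downGap (mirror w) (b + 1) = 1 then (1 : ℤ⟦X⟧) else 0 := by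
        rw [wordSum_doubleDown]
        congr 2; funext w; rw [← ite_and]; congr 1; rw [eq_iff_iff]
        refine and_congr_right fun h => ?_
        rw [climb_doubleDown h le_rfl, downGap_mirror_doubleDown h]
    _ = X * wordSum fun w => if downGap w (b + 1) = 1 then
          (if a ≤ w.count .u ∧ Climb (b + 1) w a then (1 : ℤ⟦X⟧) else 0) else 0 := by
        rw [← wordSum_mirror]
        congr 2; funext w; rw [← ite_and, mirror_mirror, climb_mirror, count_d_mirror]
        congr 1; rw [eq_iff_iff]; tauto
    _ = X ^ 2 * wordSum fun w => if b ≤ w.count .d ∧ a ≤ w.count .u ∧ Climb b w a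
          then (1 : ℤ⟦X⟧) else 0 := by
        rw [wordSum_doubleDown, ← mul_assoc, ← sq]
        congr 2; funext w; rw [← ite_and]; congr 1; rw [eq_iff_iff]
        refine and_congr_right fun h => ?_
        rw [climb_doubleDown h le_rfl, count_u_doubleDown h]
    _ = _ := by
        rw [← wordSum_mirror]
        congr 2; funext w; rw [count_d_mirror, count_u_mirror, climb_mirror]
        congr 1; rw [eq_iff_iff]
        refine ⟨fun h => h.2, fun h => ⟨?_, h⟩⟩
        have := h.2.count
        omega

end PairSeries

section Totals

open PowerSeries
open scoped Classical

local notation "M" => motzkinSeries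
local notation "Y" => motzkinStepSeries
local notation "K" => trinomialSeries
local notation "E" => 1 + X * motzkinStepSeries * trinomialSeries

/-! ### Summation over the heights -/

theorem ite_exists_eq_sum {A : Type*} [AddCommMonoid A] {ι : Type*} (p : ι → Prop) (s : Finset ι)
    (c : A) (hs : ∀ i, p i → i ∈ s) (hp : ∀ i j, p i → p j → i = j) :
    (if ∃ i, p i then c else 0) = ∑ i ∈ s, if p i then c else 0 := by
  split_ifs with h
  · obtain ⟨i, hi⟩ := h
    rw [Finset.sum_eq_single_of_mem i (hs i hi) fun j _ hj => if_neg fun h => hj (hp j i h hi),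
      if_pos hi]
  · exact (Finset.sum_eq_zero fun i _ => if_neg fun hi => h ⟨i, hi⟩).symm

/-- Sums over all heights are truncated at a height `n`. This changes them by multiples of `X ^ n`
only, which do not affect the coefficients below `X ^ n`. -/
theorem coeff_eq_of_X_pow_dvd {f g : ℤ⟦X⟧} {n N : ℕ} (h : (X : ℤ⟦X⟧) ^ n ∣ f - g) (hN : N < n) :
    coeff N f = coeff N g := by
  have := X_pow_dvd_iff.mp h N hN
  rwa [map_sub, sub_eq_zero] at this

theorem X_pow_dvd_sum_sub (n : ℕ) :
    (X : ℤ⟦X⟧) ^ n ∣ (∑ a ∈ Finset.range n, Y ^ (2 * a)) - E := by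
  have h : (∑ a ∈ Finset.range n, Y ^ (2 * a)) * (1 - Y ^ 2) = 1 - Y ^ (2 * n) := by
    induction n with
    | zero => simp
    | succ n ih => rw [Finset.sum_range_succ, add_mul, ih]; ring
  have h2 : (∑ a ∈ Finset.range n, Y ^ (2 * a)) - E = Y ^ n * (-Y ^ n * E) := by
    linear_combination E * h - (∑ a ∈ Finset.range n, Y ^ (2 * a)) * one_add_mul_one_sub_sq
  rw [h2]
  exact (X_pow_dvd_motzkinStepSeries_pow n).mul_right _

theorem X_pow_dvd_sum_mul_sub (n : ℕ) :
    (X : ℤ⟦X⟧) ^ n ∣ (∑ a ∈ Finset.range n, ((a : ℤ⟦X⟧) + 1) * Y ^ (2 * a)) - E ^ 2 := by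
  have h : (∑ a ∈ Finset.range n, ((a : ℤ⟦X⟧) + 1) * Y ^ (2 * a)) * (1 - Y ^ 2) ^ 2 =
      1 - (n + 1) * Y ^ (2 * n) + n * Y ^ (2 * n + 2) := by
    induction n with
    | zero => simp
    | succ n ih => rw [Finset.sum_range_succ, add_mul, ih]; push_cast; ring
  have h2 : (∑ a ∈ Finset.range n, ((a : ℤ⟦X⟧) + 1) * Y ^ (2 * a)) - E ^ 2 =
      Y ^ n * (Y ^ n * (-((n : ℤ⟦X⟧) + 1) + (n : ℤ⟦X⟧) * Y ^ 2) * E ^ 2) := by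
    linear_combination E ^ 2 * h - (∑ a ∈ Finset.range n, ((a : ℤ⟦X⟧) + 1) * Y ^ (2 * a)) *
      (E * (1 - Y ^ 2) + 1) * one_add_mul_one_sub_sq
  rw [h2]
  exact (X_pow_dvd_motzkinStepSeries_pow n).mul_right _

theorem Climb.le_length {a b : ℕ} {w : List MotzkinStep} (h : Climb a w b) : b ≤ a + w.length := by
  have h1 := h.count
  have h2 : w.count .u ≤ w.length := List.count_le_length
  omega

theorem Climb.unique {a b c : ℕ} {w : List MotzkinStep} (h : Climb a w b) (h' : Climb a w c) :
    b = c := by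
  have h1 := h.count
  have h2 := h'.count
  omega

/-- A path from height `a` with at most `a` down steps cannot pass below the axis. -/
theorem climb_of_count_le {a b : ℕ} {w : List MotzkinStep} (h : w.count .d ≤ a)
    (hb : a + w.count .u = b + w.count .d) : Climb a w b := by
  induction w generalizing a with
  | nil => simpa using hb
  | cons x w ih =>
    cases x
    · simp at h hb ⊢
      exact ih (by omega) (by omega)
    · simp at h hb
      obtain ⟨a, rfl⟩ : ∃ c, a = c + 1 := ⟨a - 1, by omega⟩
      simp only [climb_succ_d]
      exact ih (by omega) (by omega)
    · simp at h hb ⊢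
      exact ih (by omega) (by omega)

theorem wordSum_sub_X_pow_dvd {α : Type*} [Fintype α] {f g : List α → ℤ⟦X⟧} {n : ℕ}
    (h : ∀ w, (X : ℤ⟦X⟧) ^ n ∣ f w - g w) : (X : ℤ⟦X⟧) ^ n ∣ wordSum f - wordSum g := by
  rw [X_pow_dvd_iff]
  intro N hN
  rw [map_sub, sub_eq_zero]
  exact wordSum_congr_coeff fun w _ k hk => coeff_eq_of_X_pow_dvd (h w) (by omega)

/-- Collecting words by their end height `e w`. -/
theorem X_pow_dvd_sum_wordSum_sub (n : ℕ) (p : List MotzkinStep → Prop) [DecidablePred p]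
    (e : List MotzkinStep → ℕ) :
    (X : ℤ⟦X⟧) ^ n ∣ (∑ b ∈ Finset.range n,
      Y ^ b * wordSum fun w => if p w ∧ e w = b then 1 else 0) -
        wordSum fun w => if p w then Y ^ e w else 0 := by
  have h : (∑ b ∈ Finset.range n, Y ^ b * wordSum fun w => if p w ∧ e w = b then 1 else 0) =
      wordSum fun w => if p w ∧ e w < n then Y ^ e w else 0 := by
    simp_rw [← wordSum_mul_left, ← wordSum_sum]
    congr 1
    funext w
    by_cases hp : p w
    · simp [hp]
    · simp [hp]
  rw [h]
  refine wordSum_sub_X_pow_dvd fun w => ?_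
  by_cases hp : p w
  · by_cases he : e w < n
    · simp [hp, he]
    · simp only [hp, he, and_false, if_false, if_true, zero_sub, dvd_neg]
      exact (pow_dvd_pow _ (by omega)).trans (X_pow_dvd_motzkinStepSeries_pow _)
  · simp [hp]

/-! ### One or two distinguished letters -/

/-- `P` and `Q` form a Motzkin path, and at the height `a` of the cut, the gaps with index `a` on
both sides are `r` and `s`. -/
def OneCut (r s : ℕ) (P Q : List MotzkinStep) : Prop :=
  ∃ a, Climb 0 P a ∧ Climb a Q 0 ∧ downGap (mirror P) a = r ∧ downGap Q a = s

theorem coeff_wordSum_oneCut (r s N : ℕ) :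
    coeff N (wordSum fun P => wordSum fun Q => if OneCut (r + 1) (s + 1) P Q then 1 else 0) =
      coeff N ((X * (1 + Y)) ^ (r + s) * E) := by
  have h : coeff N (wordSum fun P => wordSum fun Q =>
        if OneCut (r + 1) (s + 1) P Q then (1 : ℤ⟦X⟧) else 0) =
      coeff N (∑ a ∈ Finset.range (N + 1), gapSeries a a (r + 1) * gapSeries a a (s + 1)) := by
    rw [wordSum_congr_coeff (g := fun P => wordSum fun Q => ∑ a ∈ Finset.range (N + 1),
      (if Climb 0 P a ∧ downGap (mirror P) a = r + 1 then (1 : ℤ⟦X⟧) else 0) *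
        if Climb a Q 0 ∧ downGap Q a = s + 1 then 1 else 0)]
    · congr 1
      simp_rw [wordSum_sum, wordSum_mul_left, wordSum_mul_right]
      refine Finset.sum_congr rfl fun a _ => ?_
      congr 1
      rw [← wordSum_mirror]
      simp_rw [mirror_mirror, climb_mirror]
      rfl
    · intro P hP k _
      congr 2
      funext Q
      unfold OneCut
      rw [ite_exists_eq_sum _ (Finset.range (N + 1))]
      · refine Finset.sum_congr rfl fun a _ => ?_
        rw [ite_zero_mul_ite_zero, one_mul]
        congr 1; rw [eq_iff_iff]; tauto
      · intro a ha
        have := ha.1.le_length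
        rw [Finset.mem_range]; omega
      · exact fun a b ha hb => ha.1.unique hb.1
  rw [h]
  refine coeff_eq_of_X_pow_dvd (n := N + 1) ?_ (by omega)
  have h2 : ∑ a ∈ Finset.range (N + 1), gapSeries a a (r + 1) * gapSeries a a (s + 1) =
      (X * (1 + Y)) ^ (r + s) * ∑ a ∈ Finset.range (N + 1), Y ^ (2 * a) := by
    rw [Finset.mul_sum]
    refine Finset.sum_congr rfl fun a _ => ?_
    rw [gapSeries_eq a a r le_rfl, gapSeries_eq a a s le_rfl]
    ring
  rw [h2, ← mul_sub]
  exact (X_pow_dvd_sum_sub _).mul_left _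

/-- `P`, `Q` and `R` form a Motzkin path, the cuts between them are at the heights `a` and `b`, and
the four gaps belonging to the two cuts are equal to `1`. The gap of index `a` to the right of the
first cut lies in `Q` or, if `Q` has too few down steps, in `R`, where its index is reduced by the
number of down steps of `Q` and by one for the mark of the second cut. By symmetry, the gap to the
left of the second cut lies in `Q` or in `P`, and it has the same index in `P` because
`a - #d = b - #u` for the numbers `#d` and `#u` of down and up steps of `Q`. -/
def TwoCutsAt (a b : ℕ) (P Q R : List MotzkinStep) : Prop :=
  Climb 0 P a ∧ Climb a Q b ∧ Climb b R 0 ∧ downGap (mirror P) a = 1 ∧ downGap R b = 1 ∧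
    if Q.count .d < a then
      downGap R (a - Q.count .d - 1) = 1 ∧ downGap (mirror P) (a - Q.count .d - 1) = 1
    else downGap Q a = 1 ∧ downGap (mirror Q) b = 1

/-- On the axis, the first gap can only be `1` if the path is empty. -/
theorem eq_nil_of_downGap_zero {b : ℕ} {w : List MotzkinStep} (h : Climb 0 w b)
    (h1 : downGap w 0 = 1) : w = [] := by
  have hp (w : List MotzkinStep) : downGap w 0 ≠ 0 := (downGap_pos w (Nat.zero_le _)).ne'
  cases w with
  | nil => rfl
  | cons x w => cases x <;> simp_all

theorem wordSum_ite_and_mul {α β : Type*} [Fintype α] [Fintype β] (p : List α → Prop)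
    (q : List β → Prop) [DecidablePred p] [DecidablePred q] :
    (wordSum fun P => wordSum fun R => if p P ∧ q R then (1 : ℤ⟦X⟧) else 0) =
      (wordSum fun P => if p P then 1 else 0) * wordSum fun R => if q R then 1 else 0 := by
  rw [← wordSum_mul_right]
  congr 1
  funext P
  rw [← wordSum_mul_left]
  congr 1
  funext R
  rw [ite_zero_mul_ite_zero, one_mul]

/-- The generating function of the triples with two cuts at the heights `a` and `b`. -/
noncomputable def twoCutSeries (a b : ℕ) : ℤ⟦X⟧ :=
  wordSum fun P => wordSum fun Q => wordSum fun R => if TwoCutsAt a b P Q R then 1 else 0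

/-- The outer two words are summed for a fixed middle word. -/
theorem twoCutSeries_eq (a b : ℕ) : twoCutSeries a b = wordSum fun Q =>
    if Climb a Q b then
      if Q.count .d < a then X ^ 2 * Y ^ (a + b - 2)
      else if downGap Q a = 1 ∧ downGap (mirror Q) b = 1 then Y ^ (a + b) else 0
    else 0 := by
  rw [twoCutSeries, wordSum_comm]
  congr 1
  funext Q
  rw [← wordSum_mirror]
  simp only [TwoCutsAt, mirror_mirror, climb_mirror]
  by_cases hQ : Climb a Q b
  · have hc := hQ.count
    rw [if_pos hQ]
    by_cases hd : Q.count .d < a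
    · obtain ⟨a, rfl⟩ : ∃ c, a = c + 1 := ⟨a - 1, by omega⟩
      obtain ⟨b, rfl⟩ : ∃ c, b = c + 1 := ⟨b - 1, by omega⟩
      rw [if_pos hd]
      have h1 := wordSum_two_gaps a (a + 1 - Q.count .d - 1) (a + 1) (by omega) (by omega)
      have h2 := wordSum_two_gaps b (a + 1 - Q.count .d - 1) (b + 1) (by omega) (by omega)
      rw [show a + 1 + (b + 1) - 2 = a + b by omega,
        show X ^ 2 * Y ^ (a + b) = (X * Y ^ a) * (X * Y ^ b) by ring, ← h1, ← h2,
        ← wordSum_ite_and_mul (fun w => Climb (a + 1) w 0 ∧ _) (fun w => Climb (b + 1) w 0 ∧ _)]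
      congr 1; funext P; congr 1; funext R
      simp only [hd, hQ, if_true]
      congr 1; rw [eq_iff_iff]; tauto
    · rw [if_neg hd]
      by_cases hg : downGap Q a = 1 ∧ downGap (mirror Q) b = 1
      · have h (a : ℕ) : gapSeries a a 1 = Y ^ a := by simpa using gapSeries_eq a a 0 le_rfl
        rw [if_pos hg, pow_add, ← h, ← h, gapSeries, gapSeries,
          ← wordSum_ite_and_mul (fun w => Climb a w 0 ∧ _) (fun w => Climb b w 0 ∧ _)]
        congr 1; funext P; congr 1; funext R
        simp only [hd, hQ, hg, if_false]
        congr 1; rw [eq_iff_iff]; tauto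
      · simp only [hd, hg, if_false, and_false, wordSum_zero]
  · simp [hQ, wordSum_zero]

theorem twoCutSeries_zero_zero : twoCutSeries 0 0 = 1 := by
  rw [twoCutSeries_eq]
  have h : (fun Q : List MotzkinStep => if Climb 0 Q 0 then
      if Q.count .d < 0 then X ^ 2 * Y ^ (0 + 0 - 2)
      else if downGap Q 0 = 1 ∧ downGap (mirror Q) 0 = 1 then Y ^ (0 + 0) else 0
    else 0) = fun Q => if Q = [] then 1 else 0 := by
    funext Q
    by_cases hQ : Q = []
    · subst hQ; simp [mirror]
    · have : Climb 0 Q 0 → downGap Q 0 ≠ 1 := fun h h1 => hQ (eq_nil_of_downGap_zero h h1)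
      by_cases hc : Climb 0 Q 0
      · simp [hQ, this hc]
      · simp [hQ, hc]
  rw [h, wordSum_eq]
  simp [wordSum_zero]

theorem twoCutSeries_zero_succ (b : ℕ) : twoCutSeries 0 (b + 1) = 0 := by
  rw [twoCutSeries_eq]
  refine Eq.trans (congrArg wordSum (funext fun Q => ?_)) wordSum_zero
  by_cases hc : Climb 0 Q (b + 1)
  · have : downGap Q 0 ≠ 1 := fun h => by
      rw [eq_nil_of_downGap_zero hc h] at hc; simp at hc
    simp [this]
  · simp [hc]

theorem twoCutSeries_succ_zero (a : ℕ) : twoCutSeries (a + 1) 0 = 0 := by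
  rw [twoCutSeries_eq]
  refine Eq.trans (congrArg wordSum (funext fun Q => ?_)) wordSum_zero
  by_cases hc : Climb (a + 1) Q 0
  · have hm := climb_mirror.mpr hc
    have : downGap (mirror Q) 0 ≠ 1 := fun h => by
      rw [eq_nil_of_downGap_zero hm h] at hm; simp at hm
    have hcount := hc.count
    simp [this, show ¬ Q.count .d < a + 1 by omega]
  · simp [hc]

theorem twoCutSeries_succ_succ (a b : ℕ) : twoCutSeries (a + 1) (b + 1) =
    X ^ 2 * Y ^ a * (Y ^ b * wordSum fun w : List MotzkinStep =>
      if w.count .d ≤ a ∧ a + w.count .u - w.count .d = b then 1 else 0) +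
    X ^ 2 * Y ^ (a + 2) * (Y ^ b * wordSum fun w : List MotzkinStep =>
      if a ≤ w.count .d ∧ Climb a w b then 1 else 0) := by
  have h : X ^ 2 * Y ^ (a + 2) * (Y ^ b * wordSum fun w : List MotzkinStep =>
      if a ≤ w.count .d ∧ Climb a w b then 1 else 0) =
      Y ^ (a + b + 2) * (X ^ 2 * wordSum fun w : List MotzkinStep =>
      if a ≤ w.count .d ∧ Climb a w b then 1 else 0) := by ring
  rw [twoCutSeries_eq, h, ← wordSum_two_sided_gaps, ← mul_assoc, ← wordSum_mul_left,
    ← wordSum_mul_left, ← wordSum_add]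
  refine congrArg wordSum (funext fun Q => ?_)
  by_cases hQ : Climb (a + 1) Q (b + 1)
  · have hc := hQ.count
    by_cases hd : Q.count .d < a + 1
    · have hg : downGap Q (a + 1) ≠ 1 := fun hg => by
        have := le_count_of_downGap_pos (w := Q) (i := a + 1) (by omega)
        omega
      simp only [hQ, hd, hg, if_true, false_and, and_false, if_false, mul_zero, add_zero,
        show Q.count .d ≤ a by omega, show a + Q.count .u - Q.count .d = b by omega, and_self]
      rw [show a + 1 + (b + 1) - 2 = a + b by omega]
      ring
    · simp only [hQ, hd, if_true, true_and, if_false, show ¬ Q.count .d ≤ a by omega, false_and,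
        mul_zero, zero_add, mul_ite, mul_one]
      rw [show a + 1 + (b + 1) = a + b + 2 by omega]
  · have h1 : ¬ (Q.count .d ≤ a ∧ a + Q.count .u - Q.count .d = b) := fun h1 =>
      hQ (climb_of_count_le (by omega) (by omega))
    simp [hQ, h1]

theorem wordSum_count_lt (a : ℕ) :
    (wordSum fun w : List MotzkinStep =>
      if w.count .d < a then Y ^ (a + w.count .u - w.count .d) else 0) = a * M * Y ^ a := by
  cases a with
  | zero => simp [wordSum_zero]
  | succ a =>
    have h := fewDownSeries_eq a
    have h2 : Y * fewDownSeries a = wordSum fun w : List MotzkinStep =>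
        if w.count .d < a + 1 then Y ^ (a + 1 + w.count .u - w.count .d) else 0 := by
      rw [fewDownSeries, ← wordSum_mul_left]
      refine congrArg wordSum (funext fun w => ?_)
      by_cases hw : w.count .d ≤ a
      · rw [if_pos hw, if_pos (by omega), ← pow_succ']
        congr 1; omega
      · rw [if_neg hw, if_neg (by omega), mul_zero]
    rw [← h2, h]
    push_cast
    ring

/-- Summation over the second height: in the first summand of `twoCutSeries_succ_succ` this gives
`fewDownSeries a`, in the second it gives `weightedPathSeries a` without the paths that have fewer
than `a` down steps. -/
theorem X_pow_dvd_sum_twoCutSeries_sub (n a : ℕ) :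
    (X : ℤ⟦X⟧) ^ n ∣ (∑ b ∈ Finset.range n, twoCutSeries (a + 1) (b + 1)) -
      X ^ 2 * ((M + Y ^ 2 * K - Y ^ 2 * M) * (((a : ℤ⟦X⟧) + 1) * Y ^ (2 * a)) +
        Y ^ 2 * M * Y ^ (2 * a)) := by
  have h1 := X_pow_dvd_sum_wordSum_sub n (fun w : List MotzkinStep => w.count .d ≤ a)
    fun w => a + w.count .u - w.count .d
  have h2 := X_pow_dvd_sum_wordSum_sub n (fun w : List MotzkinStep => a ≤ w.count .d ∧
    Climb a w (a + w.count .u - w.count .d)) fun w => a + w.count .u - w.count .d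
  have e1 : (wordSum fun w : List MotzkinStep =>
      if w.count .d ≤ a then Y ^ (a + w.count .u - w.count .d) else 0) = (a + 1) * M * Y ^ a :=
    fewDownSeries_eq a
  have e2 : (wordSum fun w : List MotzkinStep =>
      if a ≤ w.count .d ∧ Climb a w (a + w.count .u - w.count .d) then
        Y ^ (a + w.count .u - w.count .d) else 0) = (a + 1) * K * Y ^ a - a * M * Y ^ a := by
    rw [← weightedPathSeries_eq, ← wordSum_count_lt, eq_sub_iff_add_eq, ← wordSum_add]
    refine congrArg wordSum (funext fun w => ?_)
    by_cases hw : w.count .d < a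
    · have : Climb a w (a + w.count .u - w.count .d) :=
        climb_of_count_le (by omega) (by omega)
      simp [hw, this]
    · simp [hw, not_lt.mp hw]
  have e3 (b : ℕ) (w : List MotzkinStep) : (a ≤ w.count .d ∧
      Climb a w (a + w.count .u - w.count .d)) ∧ a + w.count .u - w.count .d = b ↔
      a ≤ w.count .d ∧ Climb a w b := by
    constructor
    · rintro ⟨⟨h, h'⟩, rfl⟩
      exact ⟨h, h'⟩
    · rintro ⟨h, h'⟩
      have := h'.count
      obtain rfl : a + w.count .u - w.count .d = b := by omega
      exact ⟨⟨h, h'⟩, rfl⟩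
  simp only [e3] at h2
  rw [e1] at h1
  rw [e2] at h2
  have h := dvd_add (h1.mul_left (X ^ 2 * Y ^ a)) (h2.mul_left (X ^ 2 * Y ^ (a + 2)))
  simp only [twoCutSeries_succ_succ, Finset.sum_add_distrib, ← Finset.mul_sum]
  convert h using 1
  ring

theorem coeff_sum_twoCutSeries {n N : ℕ} (hN : N < n) :
    coeff N (∑ a ∈ Finset.range (n + 1), ∑ b ∈ Finset.range (n + 1), twoCutSeries a b) =
      coeff N (1 + X ^ 4 * K ^ 3 + X ^ 2 * M + 2 * X ^ 4 * (M * (M * K))) := by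
  refine coeff_eq_of_X_pow_dvd (n := n) ?_ hN
  have h1 : ∑ a ∈ Finset.range (n + 1), ∑ b ∈ Finset.range (n + 1), twoCutSeries a b =
      (∑ a ∈ Finset.range n, ∑ b ∈ Finset.range n, twoCutSeries (a + 1) (b + 1)) + 1 := by
    simp [Finset.sum_range_succ', twoCutSeries_zero_zero, twoCutSeries_zero_succ,
      twoCutSeries_succ_zero]
  have h2 := Finset.dvd_sum fun a (_ : a ∈ Finset.range n) => X_pow_dvd_sum_twoCutSeries_sub n a
  have h3 := (X_pow_dvd_sum_mul_sub n).mul_left (X ^ 2 * (M + Y ^ 2 * K - Y ^ 2 * M))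
  have h4 := (X_pow_dvd_sum_sub n).mul_left (X ^ 2 * (Y ^ 2 * M))
  have h := dvd_add h2 (dvd_add h3 h4)
  rw [Finset.sum_sub_distrib, ← Finset.mul_sum, Finset.sum_add_distrib, ← Finset.mul_sum,
    ← Finset.mul_sum] at h
  convert h using 1
  have hK : K = M * E := by
    linear_combination E * trinomialSeries_mul_one_sub_sq - K * one_add_mul_one_sub_sq
  -- The sums over `a` are `e = 1 / (1 - Y ^ 2)` and `e ^ 2`, and `K = M * e`.
  have key : ∀ e : ℤ⟦X⟧, K = M * e → e * (1 - Y ^ 2) = 1 → X ^ 2 * K ^ 3 + M +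
      2 * X ^ 2 * (M * (M * K)) = (M + Y ^ 2 * K - Y ^ 2 * M) * e ^ 2 + Y ^ 2 * M * e := by
    intro e he1 he2
    rw [motzkinStepSeries_def] at he2 ⊢
    rw [he1]
    linear_combination -(M * e + M) * he2
  rw [h1]
  linear_combination -X ^ 2 * key E hK one_add_mul_one_sub_sq

/-- `P`, `Q` and `R` form a Motzkin path with two cuts whose four gaps are equal to `1`. -/
def TwoCuts (P Q R : List MotzkinStep) : Prop := ∃ c : ℕ × ℕ, TwoCutsAt c.1 c.2 P Q R

theorem coeff_wordSum_twoCuts (N : ℕ) :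
    coeff N (wordSum fun P => wordSum fun Q => wordSum fun R =>
      if TwoCuts P Q R then (1 : ℤ⟦X⟧) else 0) =
      coeff N (1 + X ^ 4 * K ^ 3 + X ^ 2 * M + 2 * X ^ 4 * (M * (M * K))) := by
  rw [← coeff_sum_twoCutSeries (n := 2 * N + 1) (by omega), ← Finset.sum_product']
  unfold twoCutSeries
  simp_rw [← wordSum_sum]
  -- Words `P` and `Q` of length at most `N` reach heights of at most `2 * N`.
  refine wordSum_congr_coeff fun P hP k hk => wordSum_congr_coeff fun Q hQ j _ => ?_
  congr 2
  funext R
  refine ite_exists_eq_sum _ _ _ (fun c hc => ?_) fun c c' hc hc' => ?_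
  · have h1 := hc.1.le_length
    have h2 := hc.2.1.le_length
    simp only [Finset.mem_product, Finset.mem_range]
    omega
  · have h1 := hc.1.unique hc'.1
    have h2 := hc'.2.1
    rw [← h1] at h2
    exact Prod.ext h1 (hc.2.1.unique h2)

end Totals

/-! ### Motzkin numbers -/

theorem climb_iff {a b : ℕ} {w : List MotzkinStep} : Climb a w b ↔
    a + w.count .u = b + w.count .d ∧ ∀ i, (w.take i).count .d ≤ a + (w.take i).count .u := by
  induction w generalizing a with
  | nil => simp
  | cons x w ih =>
    have hx (p : ℕ → Prop) : (∀ i, p i) ↔ p 0 ∧ ∀ i, p (i + 1) :=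
      ⟨fun h => ⟨h 0, fun i => h _⟩, fun h i => by cases i; exacts [h.1, h.2 _]⟩
    rw [hx]
    cases x
    · simp only [climb_u, ih, List.take_zero, List.take_succ_cons, List.count_nil, Nat.zero_le,
        true_and, List.count_cons_self, ne_eq, reduceCtorEq, not_false_eq_true,
        List.count_cons_of_ne]
      refine and_congr ?_ (forall_congr' fun i => ?_) <;> omega
    · cases a with
      | zero =>
        simp only [climb_zero_d, false_iff]
        rintro ⟨-, -, h⟩
        have := h 0
        simp at this
      | succ a =>
        simp only [climb_succ_d, ih, List.take_zero, List.take_succ_cons, List.count_nil,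
          Nat.zero_le, true_and, List.count_cons_self, ne_eq, reduceCtorEq, not_false_eq_true,
          List.count_cons_of_ne]
        refine and_congr ?_ (forall_congr' fun i => ?_) <;> omega
    · simp [ih]

theorem isMotzkinPath_iff {w : List MotzkinStep} : IsMotzkinPath w ↔ Climb 0 w 0 := by
  simp [climb_iff, IsMotzkinPath]

theorem motzkinNumber_of_neg {m : ℤ} (hm : m < 0) : motzkinNumber m = 0 := by
  have : motzkinPaths m = ∅ := by
    ext w
    simp only [motzkinPaths, Set.mem_ofPred_eq, Set.mem_empty_iff_false, iff_false]
    omega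
  rw [motzkinNumber, this, Set.ncard_empty]

theorem downGap_zero_eq (w : List MotzkinStep) : downGap w 0 = w.idxOf .d + 1 := by
  induction w with
  | nil => simp
  | cons x w ih => cases x <;> simp [ih, List.idxOf_cons_ne]

theorem Climb.eq_replicate {a b : ℕ} {w : List MotzkinStep} (hw : Climb a w b) (hb : b ≤ a)
    (hd : .d ∉ w) : w = List.replicate w.length .h := by
  have h := hw.count
  rw [List.count_eq_zero.mpr hd] at h
  rw [List.eq_replicate_iff]
  refine ⟨rfl, fun x hx => ?_⟩
  cases x
  · have := List.count_pos_iff.mpr hx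
    omega
  · exact absurd hx hd
  · rfl

section Coefficients

open PowerSeries
open scoped Classical

local notation "M" => motzkinSeries
local notation "Y" => motzkinStepSeries
local notation "K" => trinomialSeries

theorem motzkinNumber_natCast (N : ℕ) : (motzkinNumber N : ℤ) = coeff N M := by
  rw [motzkinSeries, descentSeries, coeff_wordSum_ite, motzkinNumber, motzkinPaths]
  congr 2
  ext w
  simp [isMotzkinPath_iff, and_comm]

theorem motzkinBallotNumber_natCast (N k : ℕ) :
    (motzkinBallotNumber N (k + 1) : ℤ) = coeff N ((X * (1 + Y)) ^ k) := by
  have h := gapSeries_eq 0 0 k le_rfl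
  rw [pow_zero, mul_one] at h
  rw [← h, gapSeries, coeff_wordSum_ite, motzkinBallotNumber, motzkinBallotPaths]
  congr 2
  ext w
  simp only [motzkinPaths, isMotzkinPath_iff, Set.mem_ofPred_eq, Nat.cast_inj, downGap_zero_eq,
    add_left_inj, Nat.cast_add, Nat.cast_one, add_sub_cancel_right, Nat.add_sub_cancel]
  constructor
  · rintro ⟨⟨h1, h2⟩, ⟨-, h3⟩ | ⟨h3, h4⟩⟩
    · exact ⟨h2, h1, h3⟩
    · refine ⟨h2, h1, ?_⟩
      rw [h4, List.idxOf_eq_length, List.length_replicate]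
      simp
  · rintro ⟨h1, h2, h3⟩
    refine ⟨⟨h2, h1⟩, ?_⟩
    by_cases hd : .d ∈ w
    · exact .inl ⟨hd, h3⟩
    · rw [List.idxOf_eq_length hd] at h3
      refine .inr ⟨by omega, ?_⟩
      have := h2.eq_replicate le_rfl hd
      rwa [h3] at this

theorem motzkinSeries_eq' : M = 1 + Y + Y ^ 2 := by
  linear_combination motzkinSeries_eq - (Y + 1) * motzkinStepSeries_def

/-- The derivative of `X * M`. -/
theorem derivative_motzkinStepSeries : d⁄dX ℤ Y = M * K := by
  have h : d⁄dX ℤ Y = d⁄dX ℤ (X * (1 + Y + Y ^ 2)) := congrArg _ motzkinStepSeries_eq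
  simp only [Derivation.leibniz, map_add, Derivation.leibniz_pow, derivative_X,
    Derivation.map_one_eq_zero, smul_eq_mul, nsmul_eq_mul] at h
  push_cast at h
  linear_combination K * h - d⁄dX ℤ Y * trinomialSeries_mul - K * motzkinSeries_eq'

theorem coeff_motzkin_mul_trinomial (N : ℕ) :
    coeff N (M * K) = ((N : ℤ) + 1) * motzkinNumber N := by
  rw [← derivative_motzkinStepSeries, coeff_derivative, motzkinStepSeries_def, coeff_succ_X_mul,
    motzkinNumber_natCast]
  ring

theorem coeff_trinomial_pow_three (N : ℕ) :
    2 * coeff N (K ^ 3) = ((N : ℤ) + 2) * (N + 1) * motzkinNumber N := by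
  have h1 := derivative_motzkinStepSeries
  have hK : K = M + Y ^ 2 * K := by linear_combination trinomialSeries_mul_one_sub_sq
  have h2 : d⁄dX ℤ (d⁄dX ℤ (X * Y)) = 2 * K ^ 3 := by
    have h3 : d⁄dX ℤ (d⁄dX ℤ Y * (1 - X - 2 * X * Y)) = d⁄dX ℤ M := by
      rw [h1]; congr 1; linear_combination M * trinomialSeries_mul
    have h4 := congrArg (d⁄dX ℤ) motzkinSeries_eq'
    have h5 : d⁄dX ℤ (2 : ℤ⟦X⟧) = 0 := by exact_mod_cast Derivation.map_natCast (d⁄dX ℤ) 2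
    simp only [Derivation.leibniz, map_add, map_sub, Derivation.leibniz_pow, derivative_X,
      Derivation.map_one_eq_zero, smul_eq_mul, nsmul_eq_mul, h5, h1] at h3 h4 ⊢
    push_cast at h3 h4 ⊢
    linear_combination X * K * (h3 + h4) -
      (X * (M * d⁄dX ℤ K + K * d⁄dX ℤ M) + 2 * M * K) * trinomialSeries_mul - 2 * K ^ 2 * hK -
      2 * K ^ 3 * (Y + X * M) * motzkinStepSeries_def
  have h3 := congrArg (coeff N) h2
  rw [coeff_derivative, coeff_derivative, coeff_succ_X_mul, motzkinStepSeries_def,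
    coeff_succ_X_mul, ← motzkinNumber_natCast, show (2 : ℤ⟦X⟧) = C 2 from rfl, coeff_C_mul] at h3
  rw [← h3]
  push_cast
  ring

end Coefficients

/-! ### Runs of a sequence of up and down steps -/

/-- The number of letters `a` of `l` that are preceded by exactly `i` letters `b`. -/
def runLength (a b : DyckStep) (l : List DyckStep) (i : ℕ) : ℕ :=
  ((Finset.range l.length).filter fun j => l[j]? = some a ∧ (l.take j).count b = i).card

theorem rStat_eq (D : DyckWord) (i : ℕ) : rStat D i = runLength .D .U D.toList i := rfl

theorem sStat_eq (D : DyckWord) (i : ℕ) : sStat D i = runLength .U .D D.toList i := rfl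

theorem runLength_cons (a b x : DyckStep) (l : List DyckStep) (i : ℕ) :
    runLength a b (x :: l) i = (if x = a ∧ i = 0 then 1 else 0) +
      if x = b then (if i = 0 then 0 else runLength a b l (i - 1)) else runLength a b l i := by
  simp only [runLength, Finset.card_filter, List.length_cons]
  rw [Finset.sum_range_succ', add_comm]
  congr 1
  · simp [eq_comm]
  · by_cases hx : x = b
    · subst hx
      cases i <;> simp
    · simp [hx]

theorem runLength_replicate_append_self {a b : DyckStep} (hab : a ≠ b) (n : ℕ) (l : List DyckStep)
    (i : ℕ) : runLength a b (List.replicate n a ++ l) i =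
      (if i = 0 then n else 0) + runLength a b l i := by
  induction n with
  | zero => simp
  | succ n ih =>
    rw [List.replicate_succ, List.cons_append, runLength_cons, if_neg hab, ih]
    split_ifs <;> simp_all; omega

theorem runLength_cons_zero {a b : DyckStep} (hab : a ≠ b) (l : List DyckStep) :
    runLength a b (b :: l) 0 = 0 := by
  simp [runLength_cons, hab.symm]

theorem runLength_cons_succ (a b : DyckStep) (l : List DyckStep) (i : ℕ) :
    runLength a b (b :: l) (i + 1) = runLength a b l i := by
  simp [runLength_cons]

/-- The step sequence with up runs of lengths `as` and down runs of lengths `bs`. -/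
def zigzag : List ℕ → List ℕ → List DyckStep
  | a :: as, b :: bs => List.replicate a .U ++ (List.replicate b .D ++ zigzag as bs)
  | _, _ => []

theorem zigzag_true (p : List Bool) (b : ℕ) (bs : List ℕ) :
    zigzag (gaps (true :: p)) (b :: bs) = .U :: (List.replicate b .D ++ zigzag (gaps p) bs) := by
  simp [gaps, zigzag]

theorem zigzag_false (p : List Bool) {bs : List ℕ} (hbs : bs ≠ []) :
    zigzag (gaps (false :: p)) bs = .U :: zigzag (gaps p) bs := by
  obtain ⟨b, bs, rfl⟩ := List.exists_cons_of_ne_nil hbs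
  obtain ⟨a, t, h⟩ := List.exists_cons_of_ne_nil (gaps_ne_nil p)
  simp [gaps, zigzag, h, List.replicate_succ]

theorem zigzag_true_right (a : ℕ) (as : List ℕ) (q : List Bool) :
    zigzag (a :: as) (gaps (true :: q)) = List.replicate a .U ++ .D :: zigzag as (gaps q) := by
  simp [gaps, zigzag]

theorem zigzag_false_right (a : ℕ) (as : List ℕ) (q : List Bool) :
    zigzag (a :: as) (gaps (false :: q)) =
      List.replicate a .U ++ .D :: zigzag (0 :: as) (gaps q) := by
  obtain ⟨b, t, h⟩ := List.exists_cons_of_ne_nil (gaps_ne_nil q)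
  simp [gaps, zigzag, h, List.replicate_succ]

theorem count_U_zigzag {as bs : List ℕ} (h : as.length = bs.length) :
    (zigzag as bs).count .U = as.sum := by
  induction as generalizing bs with
  | nil => simp [zigzag]
  | cons a as ih =>
    cases bs with
    | nil => simp at h
    | cons b bs => simp [zigzag, ih (bs := bs) (by simpa using h), List.count_replicate]

theorem count_D_zigzag {as bs : List ℕ} (h : as.length = bs.length) :
    (zigzag as bs).count .D = bs.sum := by
  induction as generalizing bs with
  | nil => cases bs <;> simp_all [zigzag]
  | cons a as ih =>
    cases bs with
    | nil => simp at h
    | cons b bs => simp [zigzag, ih (bs := bs) (by simpa using h), List.count_replicate]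

theorem runLength_down_zero (p : List Bool) (bs : List ℕ) :
    runLength .D .U (zigzag (gaps p) bs) 0 = 0 := by
  obtain ⟨a, t, h⟩ := List.exists_cons_of_ne_nil (gaps_ne_nil p)
  have ha : 0 < a := gaps_pos p a (by rw [h]; simp)
  obtain ⟨a, rfl⟩ : ∃ c, a = c + 1 := ⟨a - 1, by omega⟩
  cases bs with
  | nil => simp [h, zigzag, runLength]
  | cons b bs =>
    rw [h, zigzag, List.replicate_succ, List.cons_append, runLength_cons_zero (by decide)]

/-- The down run following the `(i+1)`-st up step of a zigzag. -/
theorem runLength_down (p : List Bool) (bs : List ℕ) (hbs : bs.length = p.count true + 1) (i : ℕ)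
    (hi : i < p.length) : runLength .D .U (zigzag (gaps p) bs) (i + 1) =
      if p[i]? = some true then bs.getD ((p.take i).count true) 0 else 0 := by
  induction p generalizing bs i with
  | nil => simp at hi
  | cons x p ih =>
    cases x
    · rw [zigzag_false _ (by rintro rfl; simp at hbs), runLength_cons_succ]
      cases i with
      | zero => simp [runLength_down_zero]
      | succ i => simpa using ih bs (by simpa using hbs) i (by simpa using hi)
    · cases bs with
      | nil => simp at hbs
      | cons b bs =>
        rw [zigzag_true, runLength_cons_succ,
          runLength_replicate_append_self (by decide)]
        cases i with
        | zero => simp [runLength_down_zero]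
        | succ i => simpa using ih bs (by simpa using hbs) i (by simpa using hi)

theorem runLength_up_zero (a : ℕ) (as : List ℕ) (q : List Bool) :
    runLength .U .D (zigzag (a :: as) (gaps q)) 0 = a := by
  cases q with
  | nil => simp [gaps, zigzag, runLength_replicate_append_self, runLength_cons_zero]
  | cons x q =>
    cases x
    · rw [zigzag_false_right, runLength_replicate_append_self (by decide),
        runLength_cons_zero (by decide)]; simp
    · rw [zigzag_true_right, runLength_replicate_append_self (by decide),
        runLength_cons_zero (by decide)]; simp

/-- The up run following the `(i+1)`-st down step of a zigzag. -/
theorem runLength_up (q : List Bool) (as : List ℕ) (has : as.length = q.count true + 1) (i : ℕ)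
    (hi : i < q.length) : runLength .U .D (zigzag as (gaps q)) (i + 1) =
      if q[i]? = some true then as.getD ((q.take (i + 1)).count true) 0 else 0 := by
  induction q generalizing as i with
  | nil => simp at hi
  | cons x q ih =>
    cases as with
    | nil => simp at has
    | cons a as =>
      cases x
      · rw [zigzag_false_right, runLength_replicate_append_self (by decide),
          runLength_cons_succ]
        cases i with
        | zero => simp [runLength_up_zero]
        | succ i =>
          have h := ih (0 :: as) (by simpa using has) i (by simpa using hi)
          simp only [Nat.add_eq_zero_iff, one_ne_zero, and_false, if_false, zero_add, h,
            List.getElem?_cons_succ, List.take_succ_cons, List.count_cons_of_ne, ne_eq,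
            reduceCtorEq, not_false_eq_true]
          by_cases hq : q[i]? = some true
          · have : (q.take (i + 1)).count true ≠ 0 := by
              rw [← Nat.pos_iff_ne_zero, List.count_pos_iff]
              rw [List.mem_take_iff_getElem]
              obtain ⟨h1, h2⟩ := List.getElem?_eq_some_iff.mp hq
              exact ⟨i, by omega, h2⟩
            obtain ⟨c, hc⟩ := Nat.exists_eq_succ_of_ne_zero this
            simp [hq, hc]
          · simp [hq]
      · rw [zigzag_true_right, runLength_replicate_append_self (by decide),
          runLength_cons_succ]
        obtain ⟨a', as, rfl⟩ : ∃ a' t, as = a' :: t :=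
          List.exists_cons_of_ne_nil (by rintro rfl; simp at has)
        cases i with
        | zero => simp [runLength_up_zero]
        | succ i => simpa using ih (a' :: as) (by simpa using has) i (by simpa using hi)

/-- Every step sequence that does not end with an up step is a zigzag after some down steps. -/
theorem exists_zigzag (l : List DyckStep) (hl : l = [] ∨ l.getLast? = some .D) :
    ∃ (c : ℕ) (as bs : List ℕ), l = List.replicate c .D ++ zigzag as bs ∧
      as.length = bs.length ∧ (∀ a ∈ as, 0 < a) ∧ ∀ b ∈ bs, 0 < b := by
  induction l with
  | nil => exact ⟨0, [], [], by simp [zigzag]⟩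
  | cons x l ih =>
    have hl' : l = [] ∨ l.getLast? = some .D := by
      cases l with
      | nil => simp
      | cons y l => simpa using hl
    obtain ⟨c, as, bs, h, hlen, has, hbs⟩ := ih hl'
    cases x
    · cases c with
      | zero =>
        cases as with
        | nil =>
          simp [zigzag] at h
          simp [h] at hl
        | cons a as =>
          cases bs with
          | nil => simp at hlen
          | cons b bs =>
            refine ⟨0, (a + 1) :: as, b :: bs, ?_, by simpa using hlen, ?_, hbs⟩
            · simp [h, zigzag, List.replicate_succ]
            · simp at has ⊢; exact has.2
      | succ c =>
        exact ⟨0, 1 :: as, (c + 1) :: bs, by simp [h, zigzag], by simpa using hlen,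
          by simpa using has, by simpa using hbs⟩
    · exact ⟨c + 1, as, bs, by simp [h, List.replicate_succ], hlen, has, hbs⟩

theorem exists_gaps (as : List ℕ) (h : as ≠ []) (has : ∀ a ∈ as, 0 < a) :
    ∃ p, gaps p = as := by
  induction as with
  | nil => exact absurd rfl h
  | cons a as ih =>
    have : ∃ p, gaps p = 1 :: as := by
      cases as with
      | nil => exact ⟨[], rfl⟩
      | cons b as =>
        obtain ⟨p, hp⟩ := ih (by simp) fun a ha => has a (by simp_all)
        exact ⟨true :: p, by simp [gaps, hp]⟩
    obtain ⟨p, hp⟩ := this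
    have key : ∀ n, ∃ p, gaps p = (n + 1) :: as := by
      intro n
      induction n with
      | zero => exact ⟨p, hp⟩
      | succ n ihn =>
        obtain ⟨q, hq⟩ := ihn
        exact ⟨false :: q, by simp [gaps, hq]⟩
    obtain ⟨q, hq⟩ := key (a - 1)
    have := has a (by simp)
    exact ⟨q, by rw [hq]; congr 1; omega⟩

/-! ### Dyck paths as coloured Motzkin paths -/

/-- Dyck steps as Motzkin steps. -/
def dyckToMotzkin : DyckStep → MotzkinStep
  | .U => .u
  | .D => .d

theorem count_u_map_dyckToMotzkin (l : List DyckStep) :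
    (l.map dyckToMotzkin).count .u = l.count .U := by
  induction l with
  | nil => rfl
  | cons x l ih => cases x <;> simp [dyckToMotzkin, ih]

theorem count_d_map_dyckToMotzkin (l : List DyckStep) :
    (l.map dyckToMotzkin).count .d = l.count .D := by
  induction l with
  | nil => rfl
  | cons x l ih => cases x <;> simp [dyckToMotzkin, ih]

theorem climb_map_dyckToMotzkin {l : List DyckStep} : Climb 0 (l.map dyckToMotzkin) 0 ↔
    l.count .U = l.count .D ∧ ∀ i, (l.take i).count .D ≤ (l.take i).count .U := by
  simp only [climb_iff, ← List.map_take, count_u_map_dyckToMotzkin, count_d_map_dyckToMotzkin,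
    zero_add]

theorem climb_replicate_d_append {a b c : ℕ} {w : List MotzkinStep} :
    Climb a (List.replicate c .d ++ w) b ↔ c ≤ a ∧ Climb (a - c) w b := by
  induction c generalizing a with
  | zero => simp
  | succ c ih =>
    cases a with
    | zero => simp [List.replicate_succ]
    | succ a => simp [List.replicate_succ, ih]

/-- A zigzag with turning points marked by `p` and `q` does not pass below the axis if and only if
marks in `q` come first. Here the list `q` also covers the first `e` down steps, which belong to up
steps made before. -/
theorem climb_zigzag (p q : List Bool) (e : ℕ) (hlen : q.length = e + p.length)
    (hc : p.count true = q.count true) :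
    Climb e ((zigzag (gaps p) (gaps q)).map dyckToMotzkin) 0 ↔
      ∀ i, (p.take i).count true ≤ (q.take (e + i)).count true := by
  have hx (P : ℕ → Prop) : (∀ i, P i) ↔ P 0 ∧ ∀ i, P (i + 1) :=
    ⟨fun h => ⟨h 0, fun i => h _⟩, fun h i => by cases i; exacts [h.1, h.2 _]⟩
  induction p generalizing q e with
  | nil =>
    have hq : q = List.replicate e false := by
      rw [List.eq_replicate_iff]
      refine ⟨by simpa using hlen, fun x hx => ?_⟩
      cases x
      · rfl
      · have := List.count_pos_iff.mpr hx
        simp at hc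
        omega
    have hg : ∀ n, gaps (List.replicate n false) = [n + 1] := by
      intro n
      induction n with
      | zero => rfl
      | succ n ih => simp [List.replicate_succ, gaps, ih]
    have h := climb_replicate_d_append (a := e + 1) (b := 0) (c := e + 1) (w := [])
    rw [List.append_nil] at h
    simp [hq, hg, gaps, zigzag, dyckToMotzkin, h]
  | cons x p ih =>
    rw [hx]
    cases x
    · rw [zigzag_false _ (gaps_ne_nil q)]
      have := ih q (e + 1) (by simp at hlen; omega) (by simpa using hc)
      simp [dyckToMotzkin, this, add_assoc, add_comm 1]
    · have hq : ∃ c r, q = List.replicate c false ++ true :: r := by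
        have : true ∈ q := by
          rw [← List.count_pos_iff, ← hc]; simp
        obtain ⟨s, t, h, hs⟩ := List.eq_append_cons_of_mem this
        have hs' : s = List.replicate s.length false := by
          rw [List.eq_replicate_iff]
          refine ⟨rfl, fun y hy => ?_⟩
          cases y
          · rfl
          · exact absurd hy hs
        exact ⟨s.length, t, hs' ▸ h⟩
      obtain ⟨c, r, rfl⟩ := hq
      have hg : gaps (List.replicate c false ++ true :: r) = (c + 1) :: gaps r := by
        clear hlen hc
        induction c with
        | zero => rfl
        | succ c ih => simp [List.replicate_succ, gaps, ih]
      rw [hg, zigzag_true]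
      simp only [List.map_cons, List.map_append, List.map_replicate, dyckToMotzkin, climb_u,
        climb_replicate_d_append, List.take_zero, List.count_nil, Nat.zero_le, true_and,
        List.take_succ_cons, List.count_cons_self]
      simp only [List.length_append, List.length_replicate, List.length_cons] at hlen
      simp only [List.count_cons_self, List.count_append, List.count_replicate] at hc
      by_cases hce : c ≤ e
      · have h := ih r (e - c) (by omega) (by simpa using hc)
        rw [show e + 1 - (c + 1) = e - c by omega]
        simp only [hce, Nat.add_le_add_iff_right, true_and]
        refine h.trans (forall_congr' fun i => ?_)
        rw [show e + (i + 1) = c + ((e - c + i) + 1) by omega, List.take_append,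
          List.length_replicate, Nat.add_sub_cancel_left, List.take_succ_cons]
        simp [List.count_replicate]
      · simp only [show ¬ c + 1 ≤ e + 1 by omega, false_and, false_iff, not_forall]
        refine ⟨0, ?_⟩
        rw [List.take_append_of_le_length (by simp; omega), List.take_replicate]
        simp [List.count_replicate]

/-- The two marks carried by the letters of a coloured Motzkin path: `none` carries both. The mark
`isDown` at position `i` says that the `i`-th up step is followed by a down step. -/
def isDown (x : Option MotzkinStep) : Bool := decide (x = none ∨ x = some .d)

/-- The mark `isUp` at position `i` says that the `i`-th down step is followed by an up step. -/
def isUp (x : Option MotzkinStep) : Bool := decide (x = none ∨ x = some .u)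

/-- The letter `none` is a second kind of horizontal step. -/
def level (x : Option MotzkinStep) : MotzkinStep := x.getD .h

theorem ext_marks {x y : Option MotzkinStep} (hd : isDown x = isDown y) (hu : isUp x = isUp y) :
    x = y := by
  rcases x with _ | _ | _ | _ <;> rcases y with _ | _ | _ | _ <;> simp_all [isDown, isUp]

theorem exists_marks (a b : Bool) : ∃ x, isDown x = a ∧ isUp x = b := by
  cases a <;> cases b
  · exact ⟨some .h, rfl, rfl⟩
  · exact ⟨some .u, rfl, rfl⟩
  · exact ⟨some .d, rfl, rfl⟩
  · exact ⟨none, rfl, rfl⟩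

theorem count_isDown (w : List (Option MotzkinStep)) :
    (w.map isDown).count true = (w.map level).count .d + w.count none := by
  induction w with
  | nil => rfl
  | cons x w ih => rcases x with _ | _ | _ | _ <;> simp [isDown, level] at ih ⊢ <;> omega

theorem count_isUp (w : List (Option MotzkinStep)) :
    (w.map isUp).count true = (w.map level).count .u + w.count none := by
  induction w with
  | nil => rfl
  | cons x w ih => rcases x with _ | _ | _ | _ <;> simp [isUp, level] at ih ⊢ <;> omega

/-- The step sequence whose peaks and valleys are marked by the letters of `w`. -/
def dyckSteps (w : List (Option MotzkinStep)) : List DyckStep :=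
  zigzag (gaps (w.map isDown)) (gaps (w.map isUp))

theorem climb_dyckSteps {w : List (Option MotzkinStep)}
    (hc : (w.map level).count .u = (w.map level).count .d) :
    Climb 0 ((dyckSteps w).map dyckToMotzkin) 0 ↔ Climb 0 (w.map level) 0 := by
  rw [dyckSteps, climb_zigzag _ _ _ (by simp) (by rw [count_isDown, count_isUp, hc]), climb_iff]
  simp only [zero_add, hc, true_and, ← List.map_take, count_isDown, count_isUp,
    Nat.add_le_add_iff_right]

theorem count_U_dyckSteps {w : List (Option MotzkinStep)}
    (hc : (w.map level).count .u = (w.map level).count .d) :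
    (dyckSteps w).count .U = w.length + 1 := by
  rw [dyckSteps, count_U_zigzag, sum_gaps, List.length_map]
  rw [length_gaps, length_gaps, count_isDown, count_isUp, hc]

theorem runLength_down_dyckSteps {w : List (Option MotzkinStep)}
    (hc : (w.map level).count .u = (w.map level).count .d) {i : ℕ} (hi : i < w.length) :
    runLength .D .U (dyckSteps w) (i + 1) = if isDown w[i] then
      gap (w.map isUp) (((w.take i).map isDown).count true) else 0 := by
  rw [dyckSteps, runLength_down _ _ _ _ (by simpa using hi)]
  · simp [hi, gap]
  · rw [length_gaps, count_isDown, count_isUp, hc]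

theorem runLength_up_dyckSteps {w : List (Option MotzkinStep)}
    (hc : (w.map level).count .u = (w.map level).count .d) {i : ℕ} (hi : i < w.length) :
    runLength .U .D (dyckSteps w) (i + 1) = if isUp w[i] then
      gap (w.map isDown) (((w.take (i + 1)).map isUp).count true) else 0 := by
  rw [dyckSteps, runLength_up _ _ _ _ (by simpa using hi)]
  · simp [hi, gap]
  · rw [length_gaps, count_isDown, count_isUp, hc]

theorem count_map_take_le (w : List (Option MotzkinStep)) (f : Option MotzkinStep → Bool) (i : ℕ) :
    ((w.take i).map f).count true ≤ (w.map f).count true :=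
  ((List.take_sublist i w).map f).count_le _

theorem runLength_down_dyckSteps_pos {w : List (Option MotzkinStep)}
    (hc : (w.map level).count .u = (w.map level).count .d) {i : ℕ} (hi : i < w.length) :
    0 < runLength .D .U (dyckSteps w) (i + 1) ↔ isDown w[i] := by
  rw [runLength_down_dyckSteps hc hi]
  split_ifs with h
  · have := count_map_take_le w isDown i
    rw [count_isDown w, ← hc, ← count_isUp] at this
    simpa [h] using gap_pos _ this
  · simp [h]

theorem runLength_up_dyckSteps_pos {w : List (Option MotzkinStep)}
    (hc : (w.map level).count .u = (w.map level).count .d) {i : ℕ} (hi : i < w.length) :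
    0 < runLength .U .D (dyckSteps w) (i + 1) ↔ isUp w[i] := by
  rw [runLength_up_dyckSteps hc hi]
  split_ifs with h
  · have := count_map_take_le w isUp (i + 1)
    rw [count_isUp w, hc, ← count_isDown] at this
    simpa [h] using gap_pos _ this
  · simp [h]

/-- The marks are recovered from the step sequence, since they say which runs are nonempty. -/
theorem dyckSteps_injective {w w' : List (Option MotzkinStep)} (hlen : w.length = w'.length)
    (hc : (w.map level).count .u = (w.map level).count .d)
    (hc' : (w'.map level).count .u = (w'.map level).count .d)
    (h : dyckSteps w = dyckSteps w') : w = w' := by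
  refine List.ext_getElem hlen fun i h1 h2 => ext_marks ?_ ?_
  · rw [Bool.eq_iff_iff, ← runLength_down_dyckSteps_pos hc h1, h, runLength_down_dyckSteps_pos hc']
  · rw [Bool.eq_iff_iff, ← runLength_up_dyckSteps_pos hc h1, h, runLength_up_dyckSteps_pos hc']

theorem exists_dyckSteps_eq (D : DyckWord) (hD : D ≠ 0) :
    ∃ w, (w.map level).count .u = (w.map level).count .d ∧ dyckSteps w = D.toList := by
  have hne := DyckWord.toList_ne_nil.mpr hD
  obtain ⟨c, as, bs, h, hlen, has, hbs⟩ := exists_zigzag D.toList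
    (.inr (by rw [List.getLast?_eq_getLast_of_ne_nil hne, D.getLast_eq_D]))
  have hc : c = 0 := by
    have hU := D.head_eq_U hne
    cases c with
    | zero => rfl
    | succ c => simp [h, List.replicate_succ] at hU
  subst hc
  rw [List.replicate_zero, List.nil_append] at h
  have has0 : as ≠ [] := by
    rintro rfl
    exact hne (by simp [h, zigzag])
  have hbs0 : bs ≠ [] := by
    rintro rfl
    exact has0 (by simpa using hlen)
  obtain ⟨p, rfl⟩ := exists_gaps as has0 has
  obtain ⟨q, rfl⟩ := exists_gaps bs hbs0 hbs
  have hsum := D.count_U_eq_count_D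
  rw [h, count_U_zigzag hlen, count_D_zigzag hlen, sum_gaps, sum_gaps] at hsum
  obtain ⟨w, rfl, rfl⟩ : ∃ w : List (Option MotzkinStep), w.map isDown = p ∧ w.map isUp = q := by
    have hpq : p.length = q.length := by omega
    clear h hlen hsum has hbs has0 hbs0
    induction p generalizing q with
    | nil => exact ⟨[], rfl, by simpa [eq_comm] using hpq⟩
    | cons a p ih =>
      cases q with
      | nil => simp at hpq
      | cons b q =>
        obtain ⟨w, h1, h2⟩ := ih q (by simpa using hpq)
        obtain ⟨x, hx, hx'⟩ := exists_marks a b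
        exact ⟨x :: w, by simp [h1, hx], by simp [h2, hx']⟩
  refine ⟨w, ?_, h.symm⟩
  rw [length_gaps, length_gaps, count_isDown, count_isUp] at hlen
  omega

/-- The factor of `dyckL` contributed by the `i`-th letter of a coloured Motzkin path. -/
def letterWeight (w : List (Option MotzkinStep)) (i : ℕ) : ℕ :=
  (runLength .D .U (dyckSteps w) (i + 1) + runLength .U .D (dyckSteps w) (i + 1)).choose
    (runLength .D .U (dyckSteps w) (i + 1))

/-- Dyck paths of semilength `m + 1` correspond to coloured Motzkin paths of length `m`. -/
theorem ncard_dyckPathsWithL (m k : ℕ) : (dyckPathsWithL (m + 1) k).ncard =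
    {w : List (Option MotzkinStep) | w.length = m ∧ Climb 0 (w.map level) 0 ∧
      ∏ i ∈ Finset.range w.length, letterWeight w i = k}.ncard := by
  have hL (w : List (Option MotzkinStep)) (D : DyckWord) (hw : dyckSteps w = D.toList)
      (hD : D.semilength = w.length + 1) :
      dyckL D = ∏ i ∈ Finset.range w.length, letterWeight w i := by
    rw [dyckL, hD, Finset.prod_Ico_eq_prod_range]
    refine Finset.prod_congr (by simp) fun i _ => ?_
    rw [rStat_eq, sStat_eq, ← hw, add_comm 1 i, letterWeight]
  have hcount (w : List (Option MotzkinStep)) (hw : Climb 0 (w.map level) 0) :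
      (w.map level).count .u = (w.map level).count .d := by simpa using hw.count
  have hdyck (w : List (Option MotzkinStep)) (hw : Climb 0 (w.map level) 0) :=
    climb_map_dyckToMotzkin.mp ((climb_dyckSteps (hcount w hw)).mpr hw)
  symm
  refine Set.ncard_congr (fun w hw => ⟨dyckSteps w, (hdyck w hw.2.1).1, (hdyck w hw.2.1).2⟩)
    ?_ ?_ ?_
  · rintro w ⟨h1, h2, h3⟩
    have hs : DyckWord.semilength ⟨dyckSteps w, (hdyck w h2).1, (hdyck w h2).2⟩ = w.length + 1 :=
      count_U_dyckSteps (hcount w h2)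
    exact ⟨by rw [hs, h1], by rw [hL w _ rfl hs, h3]⟩
  · intro w w' hw hw' h
    exact dyckSteps_injective (hw.1.trans hw'.1.symm) (hcount w hw.2.1) (hcount w' hw'.2.1)
      (congrArg DyckWord.toList h)
  · rintro D ⟨h1, h2⟩
    obtain ⟨w, hw, hwD⟩ := exists_dyckSteps_eq D (by rintro rfl; simp at h1)
    have hlen : w.length = m := by
      have := count_U_dyckSteps hw
      rw [hwD] at this
      have : D.semilength = w.length + 1 := this
      omega
    have hclimb : Climb 0 (w.map level) 0 := by
      rw [← climb_dyckSteps hw, hwD, climb_map_dyckToMotzkin]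
      exact ⟨D.count_U_eq_count_D, D.count_D_le_count_U⟩
    refine ⟨w, ⟨hlen, hclimb, ?_⟩, DyckWord.ext hwD⟩
    rw [← hL w D hwD (by omega), h2]

/-! ### The letters contributing to `dyckL` -/

theorem add_le_choose {r s : ℕ} (hr : 0 < r) (hs : 0 < s) : r + s ≤ (r + s).choose r := by
  obtain ⟨r, rfl⟩ : ∃ c, r = c + 1 := ⟨r - 1, by omega⟩
  induction r with
  | zero => simp
  | succ r ih =>
    have h1 := ih (by omega)
    have h2 : 0 < (r + 1 + s).choose (r + 1).succ := Nat.choose_pos (by omega)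
    rw [show r + 1 + 1 + s = (r + 1 + s) + 1 by omega, Nat.choose_succ_succ]
    omega

theorem choose_eq_four_iff {r s : ℕ} (hr : 0 < r) (hs : 0 < s) :
    (r + s).choose r = 4 ↔ (r = 1 ∧ s = 3) ∨ (r = 3 ∧ s = 1) := by
  constructor
  · intro h
    have := add_le_choose hr hs
    have hr4 : r ≤ 4 := by omega
    have hs4 : s ≤ 4 := by omega
    interval_cases r <;> interval_cases s <;> simp_all [Nat.choose]
  · rintro (⟨rfl, rfl⟩ | ⟨rfl, rfl⟩) <;> decide

theorem choose_eq_two_iff {r s : ℕ} (hr : 0 < r) (hs : 0 < s) :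
    (r + s).choose r = 2 ↔ r = 1 ∧ s = 1 := by
  constructor
  · intro h
    have := add_le_choose hr hs
    omega
  · rintro ⟨rfl, rfl⟩
    decide

section Letters

variable {w : List (Option MotzkinStep)}

theorem letterWeight_some (hc : (w.map level).count .u = (w.map level).count .d) {i : ℕ}
    (hi : i < w.length) (hw : w[i] ≠ none) : letterWeight w i = 1 := by
  rw [letterWeight, runLength_down_dyckSteps hc hi, runLength_up_dyckSteps hc hi]
  obtain ⟨x, hx⟩ := Option.ne_none_iff_exists'.mp hw
  rw [hx]
  cases x <;> simp [isDown, isUp]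

theorem two_le_letterWeight (hc : (w.map level).count .u = (w.map level).count .d) {i : ℕ}
    (hi : i < w.length) (hw : w[i] = none) : 2 ≤ letterWeight w i := by
  have h1 := (runLength_down_dyckSteps_pos hc hi).mpr (by rw [hw]; rfl)
  have h2 := (runLength_up_dyckSteps_pos hc hi).mpr (by rw [hw]; rfl)
  have := add_le_choose h1 h2
  rw [letterWeight]
  omega

/-- In particular, three letters `none` make the weight at least `8`. -/
theorem two_pow_le_prod_letterWeight (hc : (w.map level).count .u = (w.map level).count .d) :
    2 ^ w.count none ≤ ∏ i ∈ Finset.range w.length, letterWeight w i := by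
  have h (v : List (Option MotzkinStep)) :
      2 ^ v.count none = ∏ i ∈ Finset.range v.length, if v[i]? = some none then 2 else 1 := by
    induction v with
    | nil => rfl
    | cons x v ih =>
      rw [List.length_cons, Finset.prod_range_succ']
      cases x <;> simp [← ih, pow_succ]
  rw [h]
  refine Finset.prod_le_prod' fun i hi => ?_
  rw [Finset.mem_range] at hi
  by_cases hw : w[i] = none
  · simpa [hi, hw] using two_le_letterWeight hc hi hw
  · simp [hi, hw, letterWeight_some hc hi hw]

end Letters

theorem map_isDown_some (P : List MotzkinStep) :
    (P.map some).map isDown = P.map fun x => decide (x = .d) := by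
  rw [List.map_map]; congr 1; funext x; cases x <;> rfl

theorem map_isUp_some (P : List MotzkinStep) :
    (P.map some).map isUp = P.map fun x => decide (x = .u) := by
  rw [List.map_map]; congr 1; funext x; cases x <;> rfl

theorem map_level_some (P : List MotzkinStep) : (P.map some).map level = P := by
  rw [List.map_map]; exact List.map_id' P

/-- The two run lengths at a letter `none`. -/
theorem letterWeight_append_none {U V : List (Option MotzkinStep)}
    (hc : ((U ++ none :: V).map level).count .u = ((U ++ none :: V).map level).count .d) {r s : ℕ}
    (hr : gap (U.map isUp ++ true :: V.map isUp) ((U.map isDown).count true) = r)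
    (hs : gap (U.map isDown ++ true :: V.map isDown) ((U.map isUp).count true + 1) = s) :
    letterWeight (U ++ none :: V) U.length = (r + s).choose r ∧ 0 < r ∧ 0 < s := by
  have hi : U.length < (U ++ none :: V).length := by simp
  have hx : (U ++ none :: V)[U.length] = none := by simp
  have h1 := runLength_down_dyckSteps hc hi
  have h2 := runLength_up_dyckSteps hc hi
  have h1' := (runLength_down_dyckSteps_pos hc hi).mpr (by rw [hx]; rfl)
  have h2' := (runLength_up_dyckSteps_pos hc hi).mpr (by rw [hx]; rfl)
  rw [hx, if_pos (by rfl)] at h1 h2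
  have e1 : (U ++ none :: V).map isUp = U.map isUp ++ true :: V.map isUp := by simp [isUp]
  have e2 : (U ++ none :: V).map isDown = U.map isDown ++ true :: V.map isDown := by simp [isDown]
  have e3 : (((U ++ none :: V).take (U.length + 1)).map isUp).count true =
      (U.map isUp).count true + 1 := by
    rw [List.take_length_add_append]; simp [isUp]
  rw [e1, List.take_left, hr] at h1
  rw [e2, e3, hs] at h2
  rw [letterWeight, h1, h2]
  exact ⟨rfl, h1 ▸ h1', h2 ▸ h2'⟩

theorem climb_append_h {a b : ℕ} {P Q : List MotzkinStep} :
    Climb a (P ++ .h :: Q) b ↔ ∃ c, Climb a P c ∧ Climb c Q b := by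
  simp [climb_append]

/-- For a single letter `none`, the weight is `4` if and only if the gaps at this cut are `1` and
`3` in either order. -/
theorem one_none_iff (P Q : List MotzkinStep) :
    (Climb 0 ((P.map some ++ none :: Q.map some).map level) 0 ∧
      ∏ i ∈ Finset.range (P.map some ++ none :: Q.map some).length,
        letterWeight (P.map some ++ none :: Q.map some) i = 4) ↔
      OneCut 1 3 P Q ∨ OneCut 3 1 P Q := by
  have hl : (P.map some ++ none :: Q.map some).map level = P ++ .h :: Q := by
    rw [List.map_append, List.map_cons, map_level_some, map_level_some]; rfl
  have key {a : ℕ} (hP : Climb 0 P a) (hQ : Climb a Q 0) :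
      ∏ i ∈ Finset.range (P.map some ++ none :: Q.map some).length,
        letterWeight (P.map some ++ none :: Q.map some) i = 4 ↔
      (downGap (mirror P) a = 1 ∧ downGap Q a = 3) ∨
        (downGap (mirror P) a = 3 ∧ downGap Q a = 1) := by
    have hcl : Climb 0 ((P.map some ++ none :: Q.map some).map level) 0 := by
      rw [hl, climb_append_h]; exact ⟨a, hP, hQ⟩
    have hc := hcl.count
    rw [zero_add, zero_add] at hc
    have hPc := hP.count
    obtain ⟨h1, h2, h3⟩ := letterWeight_append_none (U := P.map some) (V := Q.map some)
      (r := downGap (mirror P) a) (s := downGap Q a) hc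
      (by
        rw [map_isUp_some, map_isDown_some, map_isUp_some, count_true_map_eq,
          gap_append_true_left _ _ (by rw [count_true_map_eq]; omega),
          downGap_mirror _ (by omega), upGap]
        congr 1; omega)
      (by
        rw [map_isUp_some, map_isDown_some, map_isDown_some, count_true_map_eq,
          show P.count .u + 1 = (P.map fun x => decide (x = .d)).count true + 1 + a by
            rw [count_true_map_eq]; omega, gap_append_true_right]
        rfl)
    rw [Finset.prod_eq_single (P.map some).length, h1, choose_eq_four_iff h2 h3]
    · intro i hi hne
      rw [Finset.mem_range] at hi
      refine letterWeight_some hc hi fun h => ?_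
      rw [List.getElem_append] at h
      split_ifs at h with hlt
      · simp at h
      · rw [List.getElem_cons] at h
        split_ifs at h with h0
        · omega
        · simp at h
    · simp
  rw [hl, climb_append_h]
  constructor
  · rintro ⟨⟨a, hP, hQ⟩, h⟩
    exact ((key hP hQ).mp h).imp (fun h => ⟨a, hP, hQ, h⟩) fun h => ⟨a, hP, hQ, h⟩
  · rintro (⟨a, hP, hQ, h⟩ | ⟨a, hP, hQ, h⟩)
    · exact ⟨⟨a, hP, hQ⟩, (key hP hQ).mpr (.inl h)⟩
    · exact ⟨⟨a, hP, hQ⟩, (key hP hQ).mpr (.inr h)⟩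

theorem mul_eq_four_iff {x y : ℕ} (hx : 2 ≤ x) (hy : 2 ≤ y) : x * y = 4 ↔ x = 2 ∧ y = 2 := by
  constructor
  · intro h
    constructor <;> nlinarith
  · rintro ⟨rfl, rfl⟩
    rfl

/-- For two letters `none`, the weight is `4` if and only if all gaps at these cuts are `1`. -/
theorem two_none_iff (P Q R : List MotzkinStep) :
    (Climb 0 ((P.map some ++ none :: (Q.map some ++ none :: R.map some)).map level) 0 ∧
      ∏ i ∈ Finset.range (P.map some ++ none :: (Q.map some ++ none :: R.map some)).length,
        letterWeight (P.map some ++ none :: (Q.map some ++ none :: R.map some)) i = 4) ↔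
      TwoCuts P Q R := by
  set w := P.map some ++ none :: (Q.map some ++ none :: R.map some) with hw
  have hl : w.map level = P ++ .h :: (Q ++ .h :: R) := by
    rw [hw, List.map_append, List.map_cons, List.map_append, List.map_cons, map_level_some,
      map_level_some, map_level_some]; rfl
  have key {a b : ℕ} (hP : Climb 0 P a) (hQ : Climb a Q b) (hR : Climb b R 0) :
      ∏ i ∈ Finset.range w.length, letterWeight w i = 4 ↔
      downGap (mirror P) a = 1 ∧ downGap R b = 1 ∧ if Q.count .d < a then
        downGap R (a - Q.count .d - 1) = 1 ∧ downGap (mirror P) (a - Q.count .d - 1) = 1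
        else downGap Q a = 1 ∧ downGap (mirror Q) b = 1 := by
    have hcl : Climb 0 (w.map level) 0 := by
      rw [hl, climb_append_h]; exact ⟨a, hP, climb_append_h.mpr ⟨b, hQ, hR⟩⟩
    have hc := hcl.count
    rw [zero_add, zero_add] at hc
    have hPc := hP.count
    have hQc := hQ.count
    have hw2 : w = (P.map some ++ none :: Q.map some) ++ none :: R.map some := by simp [hw]
    have eU : (P.map some ++ none :: Q.map some).map isUp =
        (P.map fun x => decide (x = .u)) ++ true :: Q.map fun x => decide (x = .u) := by
      rw [List.map_append, List.map_cons, map_isUp_some, map_isUp_some]; rfl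
    have eD : (P.map some ++ none :: Q.map some).map isDown =
        (P.map fun x => decide (x = .d)) ++ true :: Q.map fun x => decide (x = .d) := by
      rw [List.map_append, List.map_cons, map_isDown_some, map_isDown_some]; rfl
    have eU' : (Q.map some ++ none :: R.map some).map isUp =
        (Q.map fun x => decide (x = .u)) ++ true :: R.map fun x => decide (x = .u) := by
      rw [List.map_append, List.map_cons, map_isUp_some, map_isUp_some]; rfl
    have eD' : (Q.map some ++ none :: R.map some).map isDown =
        (Q.map fun x => decide (x = .d)) ++ true :: R.map fun x => decide (x = .d) := by
      rw [List.map_append, List.map_cons, map_isDown_some, map_isDown_some]; rfl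
    obtain ⟨h1, h2, h3⟩ := letterWeight_append_none (U := P.map some)
      (V := Q.map some ++ none :: R.map some) (r := downGap (mirror P) a)
      (s := if Q.count .d < a then downGap R (a - Q.count .d - 1) else downGap Q a) hc
      (by
        rw [map_isUp_some, map_isDown_some, count_true_map_eq,
          gap_append_true_left _ _ (by rw [count_true_map_eq]; omega),
          downGap_mirror _ (by omega), upGap]
        congr 1; omega)
      (by
        rw [map_isUp_some, map_isDown_some, eD', count_true_map_eq,
          show P.count .u + 1 = (P.map fun x => decide (x = .d)).count true + 1 + a by
            rw [count_true_map_eq]; omega, gap_append_true_right]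
        split_ifs with hd
        · rw [show gap _ a = gap _ ((Q.map fun x => decide (x = .d)).count true + 1 +
              (a - Q.count .d - 1)) by rw [count_true_map_eq]; congr 1; omega,
            gap_append_true_right]
          rfl
        · rw [gap_append_true_left _ _ (by rw [count_true_map_eq]; omega)]
          rfl)
    obtain ⟨g1, g2, g3⟩ := letterWeight_append_none (U := P.map some ++ none :: Q.map some)
      (V := R.map some)
      (r := if Q.count .d < a then downGap (mirror P) (a - Q.count .d - 1)
        else downGap (mirror Q) b) (s := downGap R b) (hw2 ▸ hc)
      (by
        rw [eU, eD, map_isUp_some, List.append_assoc, List.cons_append, List.count_append,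
          List.count_cons_self, count_true_map_eq, count_true_map_eq]
        split_ifs with hd
        · rw [gap_append_true_left _ _ (by rw [count_true_map_eq]; omega),
            downGap_mirror _ (by omega), upGap]
          congr 1; omega
        · rw [show P.count .d + (Q.count .d + 1) =
              (P.map fun x => decide (x = .u)).count true + 1 + (Q.count .d - a) by
                rw [count_true_map_eq]; omega, gap_append_true_right,
            gap_append_true_left _ _ (by rw [count_true_map_eq]; omega),
            downGap_mirror _ (by omega), upGap]
          congr 1; omega)
      (by
        rw [eU, eD, map_isDown_some, List.count_append, List.count_cons_self, count_true_map_eq,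
          count_true_map_eq, List.append_assoc, List.cons_append,
          show P.count .u + (Q.count .u + 1) + 1 =
            (P.map fun x => decide (x = .d)).count true + 1 +
              ((Q.map fun x => decide (x = .d)).count true + 1 + b) by
                rw [count_true_map_eq, count_true_map_eq]; omega,
          gap_append_true_right, gap_append_true_right]
        rfl)
    rw [← hw2] at g1
    rw [← hw] at h1
    have hlen : (P.map some).length < (P.map some ++ none :: Q.map some).length := by simp
    rw [Finset.prod_eq_mul (P.map some).length (P.map some ++ none :: Q.map some).length hlen.ne,
      h1, g1, mul_eq_four_iff (by have := add_le_choose h2 h3; omega)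
        (by have := add_le_choose g2 g3; omega), choose_eq_two_iff h2 h3, choose_eq_two_iff g2 g3]
    · split_ifs <;> tauto
    · rintro i hi ⟨hne, hne'⟩
      rw [Finset.mem_range] at hi
      refine letterWeight_some hc hi fun h => ?_
      simp only [hw] at h
      rw [List.getElem_append] at h
      split_ifs at h with hlt
      · simp at h
      · rw [List.getElem_cons] at h
        split_ifs at h with h0
        · omega
        · rw [List.getElem_append] at h
          split_ifs at h with hlt'
          · simp at h
          · rw [List.getElem_cons] at h
            split_ifs at h with h0'
            · simp only [List.length_append, List.length_map, List.length_cons] at *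
              omega
            · simp at h
    · simp [hw]
    · simp [hw]
  rw [hl, climb_append_h]
  constructor
  · rintro ⟨⟨a, hP, hQR⟩, h⟩
    obtain ⟨b, hQ, hR⟩ := climb_append_h.mp hQR
    exact ⟨(a, b), hP, hQ, hR, (key hP hQ hR).mp h⟩
  · rintro ⟨⟨a, b⟩, hP, hQ, hR, h⟩
    exact ⟨⟨a, hP, climb_append_h.mpr ⟨b, hQ, hR⟩⟩, (key hP hQ hR).mpr h⟩

/-! ### The number of Dyck paths with `L = 4` -/

section Count

open PowerSeries
open scoped Classical

local notation "M" => motzkinSeries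
local notation "Y" => motzkinStepSeries
local notation "K" => trinomialSeries

theorem not_oneCut_and {P Q : List MotzkinStep} : ¬ (OneCut 1 3 P Q ∧ OneCut 3 1 P Q) := by
  rintro ⟨⟨a, hP, -, h, -⟩, ⟨b, hP', -, h', -⟩⟩
  rw [hP.unique hP', h'] at h
  omega

/-- The coloured Motzkin paths of weight `4` have one or two letters `none`. -/
theorem wordSum_weight_four :
    (wordSum fun w : List (Option MotzkinStep) => if Climb 0 (w.map level) 0 ∧
      ∏ i ∈ Finset.range w.length, letterWeight w i = 4 then (1 : ℤ⟦X⟧) else 0) =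
    X * ((wordSum fun P => wordSum fun Q => if OneCut 1 3 P Q then (1 : ℤ⟦X⟧) else 0) +
      wordSum fun P => wordSum fun Q => if OneCut 3 1 P Q then (1 : ℤ⟦X⟧) else 0) +
    X ^ 2 * wordSum fun P => wordSum fun Q => wordSum fun R =>
      if TwoCuts P Q R then (1 : ℤ⟦X⟧) else 0 := by
  rw [wordSum_option]
  have h0 (P : List MotzkinStep) : ¬ (Climb 0 ((P.map some).map level) 0 ∧
      ∏ i ∈ Finset.range (P.map some).length, letterWeight (P.map some) i = 4) := by
    rintro ⟨h1, h2⟩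
    rw [Finset.prod_eq_one] at h2
    · omega
    · intro i hi
      exact letterWeight_some (by simpa using h1.count) (Finset.mem_range.mp hi) (by simp)
  have h3 (P Q R : List MotzkinStep) (w : List (Option MotzkinStep)) :
      ¬ (Climb 0 ((P.map some ++ none :: (Q.map some ++ none :: (R.map some ++ none :: w))).map
        level) 0 ∧ ∏ i ∈ Finset.range
          (P.map some ++ none :: (Q.map some ++ none :: (R.map some ++ none :: w))).length,
        letterWeight (P.map some ++ none :: (Q.map some ++ none :: (R.map some ++ none :: w))) i =
          4) := by
    rintro ⟨h1, h2⟩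
    have hc := h1.count
    rw [zero_add, zero_add] at hc
    have h := two_pow_le_prod_letterWeight hc
    rw [h2] at h
    have h3 : 3 ≤ (P.map some ++ none :: (Q.map some ++ none ::
        (R.map some ++ none :: w))).count none := by
      simp only [List.count_append, List.count_cons_self]
      omega
    have := Nat.pow_le_pow_right (n := 2) (by omega) h3
    omega
  have h12 (P Q : List MotzkinStep) : (if OneCut 1 3 P Q ∨ OneCut 3 1 P Q then (1 : ℤ⟦X⟧) else 0) =
      (if OneCut 1 3 P Q then 1 else 0) + if OneCut 3 1 P Q then 1 else 0 := by
    have := not_oneCut_and (P := P) (Q := Q)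
    by_cases h1 : OneCut 1 3 P Q <;> by_cases h2 : OneCut 3 1 P Q <;> simp_all
  simp only [h0, if_false, wordSum_zero, zero_add]
  have h (P : List MotzkinStep) := wordSum_option fun w => if Climb 0
    ((P.map some ++ none :: w).map level) 0 ∧ ∏ i ∈ Finset.range (P.map some ++ none :: w).length,
      letterWeight (P.map some ++ none :: w) i = 4 then (1 : ℤ⟦X⟧) else 0
  have h' (P Q : List MotzkinStep) := wordSum_option fun w => if Climb 0
    ((P.map some ++ none :: (Q.map some ++ none :: w)).map level) 0 ∧
      ∏ i ∈ Finset.range (P.map some ++ none :: (Q.map some ++ none :: w)).length,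
      letterWeight (P.map some ++ none :: (Q.map some ++ none :: w)) i = 4 then (1 : ℤ⟦X⟧) else 0
  simp only [h3, two_none_iff, if_false, wordSum_zero, mul_zero, add_zero] at h'
  simp only [one_none_iff, h', h12, wordSum_add] at h
  simp only [h, wordSum_add, wordSum_mul_left]
  ring

theorem ncard_dyckPathsWithL_four (m : ℕ) : ((dyckPathsWithL (m + 3) 4).ncard : ℤ) =
    2 * coeff (m + 1) ((X * (1 + Y)) ^ 2 * (1 + X * Y * K)) +
      coeff m (1 + X ^ 4 * K ^ 3 + X ^ 2 * M + 2 * X ^ 4 * (M * (M * K))) := by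
  have h := coeff_wordSum_ite (m + 2) fun w : List (Option MotzkinStep) =>
    Climb 0 (w.map level) 0 ∧ ∏ i ∈ Finset.range w.length, letterWeight w i = 4
  rw [ncard_dyckPathsWithL (m + 2) 4, ← h, wordSum_weight_four, map_add, coeff_succ_X_mul, map_add,
    coeff_wordSum_oneCut 0 2, coeff_wordSum_oneCut 2 0, coeff_X_pow_mul, coeff_wordSum_twoCuts]
  ring

theorem coeff_X_pow_mul_motzkinSeries (k m : ℕ) :
    coeff m (X ^ k * M) = (motzkinNumber ((m : ℤ) - k) : ℤ) := by
  rw [coeff_X_pow_mul']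
  split_ifs with h
  · rw [← motzkinNumber_natCast, Nat.cast_sub h]
  · rw [motzkinNumber_of_neg (by omega), Nat.cast_zero]

theorem coeff_X_pow_mul_mul (A B : ℤ⟦X⟧) (k m : ℕ) (a b : ℤ → ℤ) (ha : ∀ i : ℕ, a i = coeff i A)
    (hb : ∀ i : ℕ, b i = coeff i B) : coeff m (X ^ k * (A * B)) =
      ∑ i ∈ Finset.Icc (0 : ℤ) ((m : ℤ) - k), a i * b ((m : ℤ) - k - i) := by
  rw [coeff_X_pow_mul']
  split_ifs with h
  · rw [coeff_mul, Finset.Nat.sum_antidiagonal_eq_sum_range_succ fun i j => coeff i A * coeff j B]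
    refine Finset.sum_nbij (fun i : ℕ => (i : ℤ)) ?_ ?_ ?_ ?_
    · intro i hi
      simp only [Finset.mem_range, Finset.mem_Icc] at hi ⊢
      omega
    · intro i _ j _ hij
      simpa using hij
    · intro i hi
      simp only [Finset.coe_Icc, Set.mem_Icc] at hi
      exact ⟨i.toNat, by simp; omega, by simp; omega⟩
    · intro i hi
      rw [Finset.mem_range] at hi
      rw [← ha, ← hb]
      congr 2
      omega
  · rw [Finset.Icc_eq_empty (by omega), Finset.sum_empty]

theorem coeff_X_pow_four_mul_trinomial (m : ℕ) : coeff m (X ^ 4 * K ^ 3) =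
    Ring.choose ((m : ℤ) - 2) 2 * (motzkinNumber ((m : ℤ) - 4) : ℤ) := by
  rw [coeff_X_pow_mul']
  split_ifs with h
  · obtain ⟨N, rfl⟩ := Nat.exists_eq_add_of_le h
    have h1 := coeff_trinomial_pow_three N
    have h2 : ((N + 2).choose 2 : ℤ) * 2 = (N + 2) * (N + 1) := by
      have h3 := Nat.choose_two_right (N + 2)
      have h4 : 2 ∣ (N + 2) * (N + 2 - 1) := (Nat.even_mul_pred_self _).two_dvd
      have h5 : (N + 2).choose 2 * 2 = (N + 2) * (N + 1) := by
        rw [h3, Nat.div_mul_cancel h4]; rfl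
      exact_mod_cast h5
    rw [show ((4 + N : ℕ) : ℤ) - 2 = ((N + 2 : ℕ) : ℤ) by push_cast; ring, Ring.choose_natCast,
      show ((4 + N : ℕ) : ℤ) - 4 = (N : ℤ) by push_cast; ring, Nat.add_sub_cancel_left]
    refine mul_left_cancel₀ (two_ne_zero (α := ℤ)) ?_
    linear_combination h1 - motzkinNumber N * h2
  · rw [motzkinNumber_of_neg (by omega), Nat.cast_zero, mul_zero]

end Count

theorem mainTheorem6 :
    (∀ n : ℕ, 4 ≤ n →
      ((dyckPathsWithL n 4).ncard : ℤ) =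
        2 * ((motzkinBallotNumber ((n : ℤ) - 2) 3 : ℤ) +
            ∑ i ∈ Finset.Icc (0 : ℤ) ((n : ℤ) - 6),
              (i + 1) * (motzkinNumber i : ℤ) * (motzkinBallotNumber ((n : ℤ) - 4 - i) 3 : ℤ)) +
          Ring.choose ((n : ℤ) - 5) 2 * (motzkinNumber ((n : ℤ) - 7) : ℤ) +
          (motzkinNumber ((n : ℤ) - 5) : ℤ) +
          2 * ∑ i ∈ Finset.Icc (0 : ℤ) ((n : ℤ) - 7),
              (i + 1) * (motzkinNumber i : ℤ) * (motzkinNumber ((n : ℤ) - 7 - i) : ℤ)) ∧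
      (dyckPathsWithL 3 4).ncard = 1 := by
  constructor
  · intro n hn
    obtain ⟨m, rfl⟩ : ∃ m, n = m + 1 + 3 := ⟨n - 4, by omega⟩
    have hT (j : ℕ) := motzkinBallotNumber_natCast j 2
    have h1 : PowerSeries.coeff (m + 1 + 1) ((PowerSeries.X * (1 + motzkinStepSeries)) ^ 2 *
        (1 + PowerSeries.X * motzkinStepSeries * trinomialSeries)) =
        (motzkinBallotNumber ((m : ℤ) + 2) 3 : ℤ) +
          ∑ i ∈ Finset.Icc (0 : ℤ) (((m + 1 + 1 : ℕ) : ℤ) - (4 : ℕ)),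
            (i + 1) * (motzkinNumber i : ℤ) *
              (motzkinBallotNumber (((m + 1 + 1 : ℕ) : ℤ) - (4 : ℕ) - i + 2) 3 : ℤ) := by
      -- The factor `X ^ 2` of the series of `T_{m,3}` is moved out, which shifts its index by `2`.
      have e : (PowerSeries.X * (1 + motzkinStepSeries)) ^ 2 *
          (1 + PowerSeries.X * motzkinStepSeries * trinomialSeries) =
          (PowerSeries.X * (1 + motzkinStepSeries)) ^ 2 +
            PowerSeries.X ^ 4 * ((motzkinSeries * trinomialSeries) *
              (1 + motzkinStepSeries) ^ 2) := by
        linear_combination PowerSeries.X ^ 3 * (1 + motzkinStepSeries) ^ 2 * trinomialSeries *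
          motzkinStepSeries_def
      rw [e, map_add, ← hT, coeff_X_pow_mul_mul (motzkinSeries * trinomialSeries) _ 4 _
        (fun i => (i + 1) * (motzkinNumber i : ℤ)) (fun i => (motzkinBallotNumber (i + 2) 3 : ℤ))]
      · push_cast
        congr 3
      · exact fun i => (coeff_motzkin_mul_trinomial i).symm
      · intro i
        have := hT (i + 2)
        rw [mul_pow, PowerSeries.coeff_X_pow_mul] at this
        exact_mod_cast this
    have h2 := coeff_X_pow_mul_mul (motzkinSeries * trinomialSeries) motzkinSeries 4 (m + 1)
        (fun i => (i + 1) * (motzkinNumber i : ℤ)) (fun i => (motzkinNumber i : ℤ))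
        (fun i => (coeff_motzkin_mul_trinomial i).symm) motzkinNumber_natCast
    have h3 : 2 * PowerSeries.X ^ 4 * (motzkinSeries * (motzkinSeries * trinomialSeries)) =
        PowerSeries.C 2 *
          (PowerSeries.X ^ 4 * (motzkinSeries * trinomialSeries * motzkinSeries)) := by
      rw [show (PowerSeries.C 2 : PowerSeries ℤ) = 2 from rfl]; ring
    rw [ncard_dyckPathsWithL_four, h1, map_add, map_add, map_add, coeff_X_pow_four_mul_trinomial,
      coeff_X_pow_mul_motzkinSeries, h3, PowerSeries.coeff_C_mul, h2]
    have e (c d : ℤ) (h : c + d = 4) : ((m + 1 + 3 : ℕ) : ℤ) - c = m + d := by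
      push_cast; linarith
    have e1 : ((m + 1 + 1 : ℕ) : ℤ) - (4 : ℕ) = m - 2 := by push_cast; ring
    have e2 : ((m + 1 : ℕ) : ℤ) - (4 : ℕ) = m - 3 := by push_cast; ring
    have e3 : ((m + 1 : ℕ) : ℤ) - (2 : ℕ) = m - 1 := by push_cast; ring
    have e4 : ((m + 1 : ℕ) : ℤ) - 2 = m - 1 := by push_cast; ring
    have e5 : ((m + 1 : ℕ) : ℤ) - 4 = m - 3 := by push_cast; ring
    have e6 (i : ℤ) : (m : ℤ) + 0 - i = m - 2 - i + 2 := by ring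
    rw [e1, e2, e3, e4, e5, e 2 2 (by norm_num), e 4 0 (by norm_num), e 5 (-1) (by norm_num),
      e 6 (-2) (by norm_num), e 7 (-3) (by norm_num), PowerSeries.coeff_one, if_neg (by omega),
      zero_add]
    simp only [e6, ← sub_eq_add_neg]
    ring
  · have h := ncard_dyckPathsWithL_four 0
    have h0 : PowerSeries.coeff (0 + 1) ((PowerSeries.X * (1 + motzkinStepSeries)) ^ 2 *
        (1 + PowerSeries.X * motzkinStepSeries * trinomialSeries)) = 0 := by
      rw [mul_pow, mul_assoc, PowerSeries.coeff_X_pow_mul']; simp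
    have h1 : PowerSeries.coeff 0 (1 + PowerSeries.X ^ 4 * trinomialSeries ^ 3 +
        PowerSeries.X ^ 2 * motzkinSeries +
        2 * PowerSeries.X ^ 4 * (motzkinSeries * (motzkinSeries * trinomialSeries))) = 1 := by
      simp
    rw [h0, h1, mul_zero, zero_add] at h
    exact_mod_cast h
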